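/- A \emph{trigraph} $T$ consists of a finite vertex set $V(T)$ and a map $\theta:\binom{V(T)}{2}\to\{-1,0,1\}$. Distinct vertices $u,v$ are strongly adjacent, semiadjacent (a switchable pair) or strongly antiadjacent if $\theta(uv)=1,0,-1$ respectively; they are adjacent (neighbors) if $\theta(uv)\ge 0$ and antiadjacent (antineighbors) if $\theta(uv)\le 0$. The complement $\overline T$ has adjacency function $-\theta$. The full realization of $T$ is the graph on $V(T)$ whose edges are the adjacent pairs. A set $X\subseteq V(T)$ is connected (anticonnected) if the graph of adjacent (antiadjacent) pairs inside $X$ is connected, the empty set counting as both; the components of $X$, or of the restriction $T|X$ of $T$ to $X$, are the maximal nonempty connected subsets of $X$. A path of length $n$ is a sequence of distinct vertices $p_0,\dots,p_n$ in which $p_i,p_j$ are adjacent if $|i-j|=1$ and antiadjacent if $|i-j|>1$; its ends are $p_0,p_n$ and its interior consists of the other vertices. A hole of length $k\ge 4$ is a sequence of distinct vertices $h_1,\dots,h_k$ in which $h_i,h_j$ are adjacent if $|i-j|\in\{1,k-1\}$ and antiadjacent if $1<|i-j|<k-1$. Antipaths and antiholes of $T$ are paths and holes of $\overline T$. $T$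 is Berge if it has no hole and no antihole of odd length. A skew-partition of $T$ is a partition $(A,B)$ of $V(T)$ such that $A$ is not connected and $B$ is not anticonnected. It is balanced if there is no path of odd length greater than $1$ with ends in $B$ and interior in $A$, and no antipath of odd length greater than $1$ with ends in $A$ and interior in $B$. Let $\Sigma(T)$ be the graph on $V(T)$ whose edges are the switchable pairs. Let $\mathcal F$ be the class of Berge trigraphs $T$ such that every connected component of $\Sigma(T)$ has at most two edges and, for every vertex $v$ of degree two in $\Sigma(T)$, with neighbors $x,y$ in $\Sigma(T)$, either $v$ is strongly adjacent to all of $V(T)\setminus\{v,x,y\}$ and $x$ is strongly adjacent to $y$, or $v$ is strongly antiadjacent to all of $V(T)\setminus\{v,x,y\}$ and $x$ is strongly antiadjacent to $y$. A 2-join of $T$ is a partition $(X_1,X_2)$ of $V(T)$ for which there are pairwise disjoint sets $A_1,B_1,C_1,A_2,B_2,C_2$ with $X_i=A_i\cup B_i\cup C_i$ such that: $A_1,A_2,B_1,B_2$ are nonempty; no switchable pair meets both $X_1$ and $X_2$; every vertex of $A_1$ is strongly adjacent to every vertex of $A_2$, every vertex of $B_1$ is strongly adjacent to every vertex of $B_2$,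 and there are no other strong edges between $X_1$ and $X_2$; and for $i=1,2$, $|X_i|\ge 3$ and, if $|A_i|=|B_i|=1$, the full realization of $T|X_i$ is not a path of length two joining the members of $A_i$ and $B_i$. Then $(A_1,B_1,C_1,A_2,B_2,C_2)$ is called a split of $(X_1,X_2)$. The 2-join is proper if for $i=1,2$ every component of $T|X_i$ meets both $A_i$ and $B_i$ (this does not depend on the split). \textbf{Theorem.} Let $T$ be a trigraph in $\mathcal F$ that admits no balanced skew-partition, and let $(A_1,B_1,C_1,A_2,B_2,C_2)$ be a split of a 2-join $(X_1,X_2)$ of $T$. Then $(X_1,X_2)$ is a proper 2-join, and for $i=1,2$: (ii) every vertex of $X_i$ has a neighbor in $X_i$; (iii) every vertex of $A_i$ has an antineighbor in $B_i$; (iv) every vertex of $B_i$ has an antineighbor in $A_i$; (v) every vertex of $A_i$ has a neighbor in $C_i\cup B_i$; (vi) every vertex of $B_i$ has a neighbor in $C_i\cup A_i$; (vii) if $C_i=\emptyset$ then $|A_i|\ge 2$ and $|B_i|\ge 2$; (viii) $|X_i|\ge 4$. -/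

import Mathlib

/-- A trigraph with vertex set `V` (finiteness of `V` is assumed where trigraphs are used):
an adjacency function on pairs of vertices with values in `{-1, 0, 1}`.
The values `θ v v` on the diagonal carry no meaning and are never used:
every notion below refers to pairs of distinct vertices only. -/
structure Trigraph (V : Type*) where
  θ : V → V → SignType
  symm : ∀ u v, θ u v = θ v u

namespace Trigraph

variable {V : Type*} (T : Trigraph V)

/-- `u` and `v` are strongly adjacent (a strong edge). -/
def StrongAdj (u v : V) : Prop := u ≠ v ∧ T.θ u v = 1

/-- `u` and `v` are strongly antiadjacent (a strong antiedge). -/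
def StrongAntiAdj (u v : V) : Prop := u ≠ v ∧ T.θ u v = -1

/-- `u` and `v` are semiadjacent (a switchable pair). -/
def SemiAdj (u v : V) : Prop := u ≠ v ∧ T.θ u v = 0

/-- `u` and `v` are adjacent (an edge). -/
def Adj (u v : V) : Prop := T.StrongAdj u v ∨ T.SemiAdj u v

/-- `u` and `v` are antiadjacent (an antiedge). -/
def AntiAdj (u v : V) : Prop := T.StrongAntiAdj u v ∨ T.SemiAdj u v

/-- The complement of a trigraph. -/
def compl : Trigraph V where
  θ u v := -T.θ u v
  symm u v := by rw [T.symm u v]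

/-- The full realization: all switchable pairs are made edges. -/
def fullRealization : SimpleGraph V where
  Adj u v := T.Adj u v
  symm := ⟨fun u v h => by
    simpa only [Trigraph.Adj, StrongAdj, SemiAdj, ne_comm, T.symm u v] using h⟩
  loopless := ⟨fun u h => h.elim (fun h => h.1 rfl) (fun h => h.1 rfl)⟩

/-- The realization in which all switchable pairs are made antiedges. -/
def emptyRealization : SimpleGraph V where
  Adj u v := T.StrongAdj u v
  symm := ⟨fun u v h => by simpa only [StrongAdj, ne_comm, T.symm u v] using h⟩
  loopless := ⟨fun u h => h.1 rfl⟩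

/-- The graph `Σ(T)` on `V` whose edges are the switchable pairs. -/
def switchableGraph : SimpleGraph V where
  Adj u v := T.SemiAdj u v
  symm := ⟨fun u v h => by simpa only [SemiAdj, ne_comm, T.symm u v] using h⟩
  loopless := ⟨fun u h => h.1 rfl⟩

/-- `X` is connected: the full realization of `T|X` is a connected graph.
The empty set counts as connected (so that a set that is not connected
always splits into two nonempty strongly anticomplete parts). -/
def IsConnected (X : Set V) : Prop := (T.fullRealization.induce X).Preconnected

/-- `X` is anticonnected: the complement of the realization of `T|X` that makes all switchable
pairs antiedges is a connected graph. The empty set counts as anticonnected. -/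
def IsAnticonnected (X : Set V) : Prop := ((T.emptyRealization.induce X)ᶜ).Preconnected

/-- `K` is a (connected) component of `X`: a maximal nonempty connected subset of `X`. -/
def IsComponent (X K : Set V) : Prop :=
  Maximal (fun S : Set V => S.Nonempty ∧ S ⊆ X ∧ T.IsConnected S) K

/-- `p 0, …, p n` is a path of length `n` (consecutive vertices are adjacent,
all other pairs are antiadjacent). -/
def IsPath (n : ℕ) (p : Fin (n + 1) → V) : Prop :=
  Function.Injective p ∧
    ∀ i j : Fin (n + 1), i < j →
      ((j : ℕ) - i = 1 → T.Adj (p i) (p j)) ∧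
      (1 < (j : ℕ) - i → T.AntiAdj (p i) (p j))

/-- `p 0, …, p n` is an antipath of length `n`: a path of the complement. -/
def IsAntipath (n : ℕ) (p : Fin (n + 1) → V) : Prop := T.compl.IsPath n p

/-- `h 0, …, h (k - 1)` is a hole of length `k`, in cyclic order. -/
def IsHole (k : ℕ) (h : Fin k → V) : Prop :=
  4 ≤ k ∧ Function.Injective h ∧
    ∀ i j : Fin k, i < j →
      (((j : ℕ) - i = 1 ∨ (j : ℕ) - i = k - 1) → T.Adj (h i) (h j)) ∧
      ((1 < (j : ℕ) - i ∧ (j : ℕ) - i < k - 1) → T.AntiAdj (h i) (h j))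

/-- An antihole: a hole of the complement. -/
def IsAntihole (k : ℕ) (h : Fin k → V) : Prop := T.compl.IsHole k h

/-- A trigraph is Berge if it has no odd hole and no odd antihole. -/
def IsBerge : Prop :=
  ∀ (k : ℕ) (h : Fin k → V), Odd k → ¬ T.IsHole k h ∧ ¬ T.IsAntihole k h

/-- The sequence `p 0, …, p n` has both ends in `Y` and its interior in `Z`. -/
def EndsInteriorIn (n : ℕ) (p : Fin (n + 1) → V) (Y Z : Set V) : Prop :=
  p 0 ∈ Y ∧ p (Fin.last n) ∈ Y ∧ ∀ i : Fin (n + 1), i ≠ 0 → i ≠ Fin.last n → p i ∈ Z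

/-- The pair `(A, B)` of disjoint sets is balanced. -/
def IsBalanced (A B : Set V) : Prop :=
  (∀ (n : ℕ) (p : Fin (n + 1) → V), Odd n → 1 < n → T.IsPath n p →
    ¬ EndsInteriorIn n p B A) ∧
  (∀ (n : ℕ) (p : Fin (n + 1) → V), Odd n → 1 < n → T.IsAntipath n p →
    ¬ EndsInteriorIn n p A B)

/-- `(A, B)` is a skew-partition of `T`. -/
def IsSkewPartition (A B : Set V) : Prop :=
  A ∪ B = Set.univ ∧ Disjoint A B ∧ ¬ T.IsConnected A ∧ ¬ T.IsAnticonnected B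

/-- `T` admits a balanced skew-partition. -/
def HasBalancedSkewPartition : Prop :=
  ∃ A B : Set V, T.IsSkewPartition A B ∧ T.IsBalanced A B

/-- `v` is a heavy vertex, with neighbours `x` and `y` in the graph of switchable pairs. -/
def IsHeavy (v x y : V) : Prop :=
  (∀ w : V, w ∉ ({v, x, y} : Set V) → T.StrongAdj v w) ∧ T.StrongAdj x y

/-- `v` is a light vertex, with neighbours `x` and `y` in the graph of switchable pairs. -/
def IsLight (v x y : V) : Prop :=
  (∀ w : V, w ∉ ({v, x, y} : Set V) → T.StrongAntiAdj v w) ∧ T.StrongAntiAdj x y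

/-- The class `F` of Berge trigraphs: every switchable component has at most two edges, and
every vertex that lies in two switchable pairs is heavy or light. -/
structure InClassF : Prop where
  berge : T.IsBerge
  component_edges : ∀ c : T.switchableGraph.ConnectedComponent,
    c.toSimpleGraph.edgeSet.ncard ≤ 2
  heavy_or_light : ∀ v x y : V, x ≠ y → T.switchableGraph.neighborSet v = {x, y} →
    T.IsHeavy v x y ∨ T.IsLight v x y

/-- `(A 0, B 0, C 0, A 1, B 1, C 1)` is a split of the 2-join `(X 0, X 1)` of `T`
(the two sides are indexed by `0, 1`). -/
structure IsTwoJoinSplit (X A B C : Fin 2 → Set V) : Prop where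
  cover : X 0 ∪ X 1 = Set.univ
  disjoint_sides : Disjoint (X 0) (X 1)
  side_eq : ∀ i, X i = A i ∪ B i ∪ C i
  disjoint_AB : ∀ i, Disjoint (A i) (B i)
  disjoint_AC : ∀ i, Disjoint (A i) (C i)
  disjoint_BC : ∀ i, Disjoint (B i) (C i)
  nonempty_A : ∀ i, (A i).Nonempty
  nonempty_B : ∀ i, (B i).Nonempty
  no_switchable : ∀ u ∈ X 0, ∀ v ∈ X 1, ¬ T.SemiAdj u v
  strong_A : ∀ u ∈ A 0, ∀ v ∈ A 1, T.StrongAdj u v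
  strong_B : ∀ u ∈ B 0, ∀ v ∈ B 1, T.StrongAdj u v
  no_other : ∀ u ∈ X 0, ∀ v ∈ X 1, T.StrongAdj u v →
    (u ∈ A 0 ∧ v ∈ A 1) ∨ (u ∈ B 0 ∧ v ∈ B 1)
  three_le : ∀ i, 3 ≤ (X i).ncard
  /-- If `A i` and `B i` are singletons, the full realization of `T|X i` is not a path of
  length two joining their members. -/
  not_path : ∀ i, ¬ ∃ a c b : V, A i = {a} ∧ B i = {b} ∧ X i = {a, c, b} ∧
    T.fullRealization.Adj a c ∧ T.fullRealization.Adj c b ∧ ¬ T.fullRealization.Adj a b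

/-- `(X 0, X 1)` is a 2-join of `T`. -/
def IsTwoJoin (X : Fin 2 → Set V) : Prop :=
  ∃ A B C : Fin 2 → Set V, T.IsTwoJoinSplit X A B C

/-- `(X 0, X 1)` is a proper 2-join of `T`: for `i = 0, 1`, every component of `T|X i` meets both
`A i` and `B i` (this does not depend on the split; it is required here for all of them). -/
def IsProperTwoJoin (X : Fin 2 → Set V) : Prop :=
  T.IsTwoJoin X ∧ ∀ A B C : Fin 2 → Set V, T.IsTwoJoinSplit X A B C →
    ∀ (i : Fin 2) (K : Set V), T.IsComponent (X i) K →
      (K ∩ A i).Nonempty ∧ (K ∩ B i).Nonempty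

end Trigraph

/-! ### Adjacency and the complement -/

namespace Trigraph

variable {V : Type*} {T : Trigraph V}

/-! Each conclusion is proved by contradiction: its failure exposes a cutset that yields a balanced
skew-partition. Nearly all these cutsets are stars, a vertex with some of its strong neighbours
(`hasBalancedSkewPartition_of_star`). Balance is mostly checked by finding a vertex adjacent to the
ends of an odd path and antiadjacent to its interior, which would close an odd hole
(`IsBerge.even_of_center`), or dually for antipaths. In a 2-join such a vertex is usually available
in `A 0`, `B 0`, `A 1` or `B 1`.

The base is `eq_singleton_of_closed`: a union of components of `X 0` missing `B 0` can only be the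
single vertex of `A 0`, and the bound of three on the size of a side then excludes it. So every
component meets `A 0` and `B 0`, and each side contains a path from its `A`-part to its `B`-part
through its `C`-part. Two such paths on opposite sides form a hole, so all of them have one common
parity (`even_add`). This parity settles the paths for which no single vertex closes a hole, both
for antineighbours across a side (`exists_antiAdj`) and for neighbours outside `A 0` (`exists_adj`).

The size bounds follow. If `C 0` is empty and `A 0` is a single vertex, that vertex is semiadjacent
to all of `B 0`, which the class `F` forbids. A side with three vertices, one of them in `C 0`, is
either the excluded path of length two or a triangle containing paths of both parities. -/

theorem compl_adj {u v : V} : T.compl.Adj u v ↔ T.AntiAdj u v := by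
  simp [Adj, AntiAdj, StrongAdj, StrongAntiAdj, SemiAdj, compl, neg_eq_iff_eq_neg]

theorem compl_antiAdj {u v : V} : T.compl.AntiAdj u v ↔ T.Adj u v := by
  simp [Adj, AntiAdj, StrongAdj, StrongAntiAdj, SemiAdj, compl, neg_eq_iff_eq_neg]

theorem compl_compl : T.compl.compl = T := by
  cases T; simp [compl]

theorem IsBerge.compl (h : T.IsBerge) : T.compl.IsBerge := fun k f hk =>
  ⟨(h k f hk).2, by rw [IsAntihole, compl_compl]; exact (h k f hk).1⟩

theorem StrongAdj.symm {u v : V} (h : T.StrongAdj u v) : T.StrongAdj v u :=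
  ⟨h.1.symm, T.symm u v ▸ h.2⟩

theorem StrongAntiAdj.symm {u v : V} (h : T.StrongAntiAdj u v) : T.StrongAntiAdj v u :=
  ⟨h.1.symm, T.symm u v ▸ h.2⟩

theorem SemiAdj.symm {u v : V} (h : T.SemiAdj u v) : T.SemiAdj v u :=
  ⟨h.1.symm, T.symm u v ▸ h.2⟩

theorem Adj.symm {u v : V} (h : T.Adj u v) : T.Adj v u :=
  h.imp StrongAdj.symm SemiAdj.symm

theorem AntiAdj.symm {u v : V} (h : T.AntiAdj u v) : T.AntiAdj v u :=
  h.imp StrongAntiAdj.symm SemiAdj.symm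

theorem Adj.ne {u v : V} (h : T.Adj u v) : u ≠ v := h.elim And.left And.left

theorem AntiAdj.ne {u v : V} (h : T.AntiAdj u v) : u ≠ v := h.elim And.left And.left

theorem StrongAdj.adj {u v : V} (h : T.StrongAdj u v) : T.Adj u v := Or.inl h

theorem StrongAdj.not_antiAdj {u v : V} (h : T.StrongAdj u v) : ¬ T.AntiAdj u v := by
  rintro (h' | h') <;> simp [StrongAdj, StrongAntiAdj, SemiAdj] at * <;> simp_all

theorem antiAdj_of_not_strongAdj {u v : V} (hne : u ≠ v) (h : ¬ T.StrongAdj u v) :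
    T.AntiAdj u v := by
  simp only [StrongAdj, AntiAdj, StrongAntiAdj, SemiAdj, hne, ne_eq, not_false_eq_true,
    true_and] at *
  revert h
  generalize T.θ u v = x
  revert x
  decide

theorem antiAdj_of_not_adj {u v : V} (hne : u ≠ v) (h : ¬ T.Adj u v) : T.AntiAdj u v :=
  antiAdj_of_not_strongAdj hne fun h' => h h'.adj

theorem semiAdj_of_adj_of_antiAdj {u v : V} (h : T.Adj u v) (h' : T.AntiAdj u v) :
    T.SemiAdj u v :=
  h.resolve_left fun h => h.not_antiAdj h'

/-! ### Paths indexed by natural numbers, and parity in Berge trigraphs -/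

/-- `q 0, …, q n` is a path of length `n`; the values of `q` beyond `n` are irrelevant. -/
structure IsPathSeq (T : Trigraph V) (n : ℕ) (q : ℕ → V) : Prop where
  adj : ∀ i, i < n → T.Adj (q i) (q (i + 1))
  antiAdj : ∀ i j, i + 2 ≤ j → j ≤ n → T.AntiAdj (q i) (q j)

/-- Indexing by `ℕ` reduces reversals and subpaths to index arithmetic. Injectivity need not be
carried along, since adjacent and antiadjacent pairs are distinct by definition. -/
theorem IsPath.exists_isPathSeq {n : ℕ} {p : Fin (n + 1) → V} (hp : T.IsPath n p) :
    ∃ q : ℕ → V, T.IsPathSeq n q ∧ ∀ i : Fin (n + 1), p i = q i := by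
  refine ⟨fun i => p ⟨min i n, by omega⟩, ⟨fun i hi => ?_, fun i j hij hj => ?_⟩, fun i => ?_⟩
  · exact (hp.2 _ _ (by simp only [Fin.mk_lt_mk]; omega)).1 (by simp only []; omega)
  · exact (hp.2 _ _ (by simp only [Fin.mk_lt_mk]; omega)).2 (by simp only []; omega)
  · congr 1
    ext
    simp only []
    omega

namespace IsPathSeq

variable {n : ℕ} {q : ℕ → V}

theorem reverse (h : T.IsPathSeq n q) : T.IsPathSeq n (fun i => q (n - i)) where
  adj i hi := by
    have := (h.adj (n - (i + 1)) (by omega)).symm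
    rwa [show n - (i + 1) + 1 = n - i by omega] at this
  antiAdj i j hij hj := (h.antiAdj (n - j) (n - i) (by omega) (by omega)).symm

theorem sub (h : T.IsPathSeq n q) {k m : ℕ} (hk : k + m ≤ n) :
    T.IsPathSeq m (fun i => q (k + i)) where
  adj i hi := h.adj (k + i) (by omega)
  antiAdj i j hij hj := h.antiAdj (k + i) (k + j) (by omega) (by omega)

end IsPathSeq

/-- Two paths whose ends are joined in a cyclic way, all other pairs being antiadjacent,
form a hole. -/
theorem IsBerge.even_of_isPathSeq_of_isPathSeq (hT : T.IsBerge) {s t : ℕ} {p q : ℕ → V}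
    (hp : T.IsPathSeq s p) (hq : T.IsPathSeq t q) (hst : 2 ≤ s + t)
    (h₁ : T.Adj (p s) (q 0)) (h₂ : T.Adj (p 0) (q t))
    (h : ∀ i ≤ s, ∀ j ≤ t, ¬ (i = s ∧ j = 0) → ¬ (i = 0 ∧ j = t) → T.AntiAdj (p i) (q j)) :
    Even (s + t) := by
  by_contra hodd
  rw [Nat.not_even_iff_odd] at hodd
  -- `p` followed by `q`, a cyclic sequence of `s + t + 2` vertices, which has the parity of `s +
  -- t`.
  let f : Fin (s + t + 2) → V := fun i => if i.1 ≤ s then p i else q (i - (s + 1))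
  have key : ∀ i j : Fin (s + t + 2), i < j →
      (((j : ℕ) - i = 1 ∨ (j : ℕ) - i = s + t + 2 - 1) → T.Adj (f i) (f j)) ∧
      ((1 < (j : ℕ) - i ∧ (j : ℕ) - i < s + t + 2 - 1) → T.AntiAdj (f i) (f j)) := by
    rintro ⟨i, hi⟩ ⟨j, hj⟩ hij
    simp only [Fin.mk_lt_mk] at hij
    simp only [f]
    by_cases hjs : j ≤ s
    · rw [if_pos (by omega), if_pos hjs]
      refine ⟨fun hd => ?_, fun hd => hp.antiAdj _ _ (by omega) hjs⟩
      obtain rfl : j = i + 1 := by omega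
      exact hp.adj i (by omega)
    · by_cases his : i ≤ s
      · rw [if_pos his, if_neg hjs]
        refine ⟨fun hd => ?_, fun hd => h _ his _ (by omega) (by omega) (by omega)⟩
        by_cases hi0 : i = s ∧ j = s + 1
        · obtain ⟨rfl, rfl⟩ := hi0
          simpa using h₁
        · obtain ⟨rfl, rfl⟩ : i = 0 ∧ j = s + t + 1 := by omega
          rwa [show s + t + 1 - (s + 1) = t by omega]
      · rw [if_neg his, if_neg hjs]
        refine ⟨fun hd => ?_, fun hd => hq.antiAdj _ _ (by omega) (by omega)⟩
        obtain rfl : j = i + 1 := by omega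
        have := hq.adj (i - (s + 1)) (by omega)
        rwa [show i - (s + 1) + 1 = i + 1 - (s + 1) by omega] at this
  have hne : ∀ i j : Fin (s + t + 2), i < j → f i ≠ f j := fun i j hij => by
    have hij' : i.1 < j.1 := hij
    have hj := j.2
    by_cases hd : (j : ℕ) - i = 1 ∨ (j : ℕ) - i = s + t + 2 - 1
    · exact ((key i j hij).1 hd).ne
    · exact ((key i j hij).2 (by omega)).ne
  refine (hT (s + t + 2) f (by simpa [parity_simps] using hodd)).1 ⟨by omega, ?_, key⟩
  intro i j hij
  rcases lt_trichotomy i j with h | h | h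
  · exact (hne _ _ h hij).elim
  · exact h
  · exact (hne _ _ h hij.symm).elim

/-- In a Berge trigraph, a path of length at least two is even if some vertex is adjacent to its
ends and antiadjacent to its interior. -/
theorem IsBerge.even_of_center (hT : T.IsBerge) {n : ℕ} {q : ℕ → V} (hq : T.IsPathSeq n q)
    (hn : 2 ≤ n) {v : V} (h₀ : T.Adj v (q 0)) (h₁ : T.Adj v (q n))
    (h : ∀ i, 0 < i → i < n → T.AntiAdj v (q i)) : Even n := by
  refine hT.even_of_isPathSeq_of_isPathSeq (t := 0) (q := fun _ => v) hq
    ⟨fun i hi => by omega, fun i j hij hj => by omega⟩ (by omega) h₁.symm h₀.symm ?_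
  intro i hi j hj h2 h3
  exact (h i (by omega) (by omega)).symm

/-- The same for antipaths. -/
theorem IsBerge.even_of_center_compl (hT : T.IsBerge) {n : ℕ} {q : ℕ → V}
    (hq : T.compl.IsPathSeq n q) (hn : 2 ≤ n) {v : V} (h₀ : T.AntiAdj v (q 0))
    (h₁ : T.AntiAdj v (q n)) (h : ∀ i, 0 < i → i < n → T.Adj v (q i)) : Even n :=
  hT.compl.even_of_center hq hn (compl_adj.2 h₀) (compl_adj.2 h₁)
    fun i h0 hi => compl_antiAdj.2 (h i h0 hi)

/-! ### Criteria for balanced skew-partitions -/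

/-- A walk inside `X` cannot leave `S`. Only the trace of `S` on `X` matters, so later `S` may
overlap the cutset. -/
theorem not_isConnected_of_closed {X S : Set V}
    (hS : ∀ u ∈ X, ∀ w ∈ X, u ∈ S → T.Adj u w → w ∈ S)
    (h₁ : ∃ u ∈ X, u ∈ S) (h₂ : ∃ w ∈ X, w ∉ S) : ¬ T.IsConnected X := by
  intro h
  obtain ⟨u, hu, huS⟩ := h₁
  obtain ⟨w, hw, hwS⟩ := h₂
  obtain ⟨r⟩ := h ⟨u, hu⟩ ⟨w, hw⟩
  have : ∀ {x y : X} (r : (T.fullRealization.induce X).Walk x y), x.1 ∈ S → y.1 ∈ S := by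
    intro x y r
    induction r with
    | nil => exact id
    | cons hadj _ ih => exact fun hx => ih (hS _ (Subtype.prop _) _ (Subtype.prop _) hx hadj)
  exact hwS (this r huS)

theorem not_isAnticonnected_of_closed {X S : Set V}
    (hS : ∀ u ∈ X, ∀ w ∈ X, u ∈ S → w ∉ S → T.StrongAdj u w)
    (h₁ : ∃ u ∈ X, u ∈ S) (h₂ : ∃ w ∈ X, w ∉ S) : ¬ T.IsAnticonnected X := by
  intro h
  obtain ⟨u, hu, huS⟩ := h₁
  obtain ⟨w, hw, hwS⟩ := h₂
  obtain ⟨r⟩ := h ⟨u, hu⟩ ⟨w, hw⟩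
  have : ∀ {x y : X} (r : ((T.emptyRealization.induce X)ᶜ).Walk x y), x.1 ∈ S → y.1 ∈ S := by
    intro x y r
    induction r with
    | nil => exact id
    | cons hadj _ ih =>
      refine fun hx => ih ?_
      by_contra hy
      exact ((SimpleGraph.compl_adj _ _ _).1 hadj).2
        (hS _ (Subtype.prop _) _ (Subtype.prop _) hx hy)
  exact hwS (this r huS)

/-- Only paths of odd length at least three and antipaths of odd length at least five matter for
balancedness, since an antipath of length three is a path of length three. -/
theorem isBalanced_of_isPathSeq {A B : Set V}
    (h₁ : ∀ n q, Odd n → 3 ≤ n → T.IsPathSeq n q → q 0 ∈ B → q n ∈ B →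
      (∀ i, 0 < i → i < n → q i ∈ A) → False)
    (h₂ : ∀ n q, Odd n → 5 ≤ n → T.compl.IsPathSeq n q → q 0 ∈ A → q n ∈ A →
      (∀ i, 0 < i → i < n → q i ∈ B) → False) :
    T.IsBalanced A B := by
  have aux : ∀ (n : ℕ) (p : Fin (n + 1) → V) (q : ℕ → V) (Y Z : Set V),
      (∀ i : Fin (n + 1), p i = q i) → EndsInteriorIn n p Y Z →
      q 0 ∈ Y ∧ q n ∈ Y ∧ ∀ i, 0 < i → i < n → q i ∈ Z := by
    rintro n p q Y Z hpq ⟨e0, e1, e2⟩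
    refine ⟨by simpa [hpq] using e0, by simpa [hpq] using e1, fun i h0 hi => ?_⟩
    have := e2 ⟨i, by omega⟩ (by simp [Fin.ext_iff]; omega) (by simp [Fin.ext_iff]; omega)
    simpa [hpq] using this
  refine ⟨fun n p hn h1 hp he => ?_, fun n p hn h1 hp he => ?_⟩
  · obtain ⟨q, hq, hpq⟩ := hp.exists_isPathSeq
    obtain ⟨e0, e1, e2⟩ := aux n p q _ _ hpq he
    exact h₁ n q hn (by obtain ⟨k, rfl⟩ := hn; omega) hq e0 e1 e2
  · obtain ⟨q, hq, hpq⟩ := IsPath.exists_isPathSeq (T := T.compl) hp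
    obtain ⟨e0, e1, e2⟩ := aux n p q _ _ hpq he
    by_cases h5 : 5 ≤ n
    · exact h₂ n q hn h5 hq e0 e1 e2
    · obtain rfl : n = 3 := by obtain ⟨k, rfl⟩ := hn; omega
      have a02 := compl_antiAdj.1 (hq.antiAdj 0 2 (by omega) (by omega))
      have a03 := compl_antiAdj.1 (hq.antiAdj 0 3 (by omega) (by omega))
      have a13 := compl_antiAdj.1 (hq.antiAdj 1 3 (by omega) (by omega))
      have b01 := compl_adj.1 (hq.adj 0 (by omega))
      have b12 := compl_adj.1 (hq.adj 1 (by omega))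
      have b23 := compl_adj.1 (hq.adj 2 (by omega))
      -- The path with three edges is self-complementary: in the order 2, 0, 3, 1 the antipath
      -- becomes a path, and its ends and interior change roles.
      let r : ℕ → V := fun i => match i with
        | 0 => q 2
        | 1 => q 0
        | 2 => q 3
        | _ => q 1
      refine h₁ 3 r hn le_rfl ⟨fun i hi => ?_, fun i j hij hj => ?_⟩ (e2 2 (by omega) (by omega))
        (e2 1 (by omega) (by omega)) fun i h0 hi => ?_
      · interval_cases i
        · exact a02.symm
        · exact a03
        · exact a13.symm
      · obtain ⟨rfl, rfl⟩ | ⟨rfl, rfl⟩ | ⟨rfl, rfl⟩ :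
            i = 0 ∧ j = 2 ∨ i = 0 ∧ j = 3 ∨ i = 1 ∧ j = 3 := by omega
        · exact b23
        · exact b12.symm
        · exact b01
      · interval_cases i
        · exact e0
        · exact e1

/-- A criterion for the existence of a balanced skew-partition `(Bᶜ, B)`. -/
theorem hasBalancedSkewPartition_of (B S R : Set V)
    (hS : ∀ u ∉ B, ∀ w ∉ B, u ∈ S → T.Adj u w → w ∈ S)
    (hS₁ : ∃ u ∉ B, u ∈ S) (hS₂ : ∃ w ∉ B, w ∉ S)
    (hR : ∀ u ∈ B, ∀ w ∈ B, u ∈ R → w ∉ R → T.StrongAdj u w)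
    (hR₁ : ∃ u ∈ B, u ∈ R) (hR₂ : ∃ w ∈ B, w ∉ R)
    (h₁ : ∀ n q, Odd n → 3 ≤ n → T.IsPathSeq n q → q 0 ∈ B → q n ∈ B →
      (∀ i, 0 < i → i < n → q i ∉ B) → False)
    (h₂ : ∀ n q, Odd n → 5 ≤ n → T.compl.IsPathSeq n q → q 0 ∉ B → q n ∉ B →
      (∀ i, 0 < i → i < n → q i ∈ B) → False) :
    T.HasBalancedSkewPartition :=
  ⟨Bᶜ, B, ⟨Set.compl_union_self B, disjoint_compl_left, not_isConnected_of_closed hS hS₁ hS₂,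
    not_isAnticonnected_of_closed hR hR₁ hR₂⟩, isBalanced_of_isPathSeq h₁ h₂⟩

/-! ### Path interiors, shortest walks and components -/

/-- Used to trap the interior of a path or antipath on one side of the 2-join, or in one part of it,
from the position of its first interior vertex. -/
theorem IsPathSeq.interior_mem {n : ℕ} {q : ℕ → V} (hq : T.IsPathSeq n q) {P : V → Prop}
    (h₁ : P (q 1)) (hP : ∀ i, 0 < i → i + 1 < n → P (q i) → T.Adj (q i) (q (i + 1)) →
      P (q (i + 1))) : ∀ i, 0 < i → i < n → P (q i) := by
  intro i h0 hi
  induction i with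
  | zero => omega
  | succ k ih =>
    rcases Nat.eq_zero_or_pos k with rfl | hk
    · exact h₁
    · exact hP k hk hi (ih hk (by omega)) (hq.adj k (by omega))

/-- A shortest walk in `X` from `A` to `B` is a path whose interior avoids `A` and `B`. -/
theorem exists_isPathSeq_of_walk {X A B : Set V} (hAB : Disjoint A B)
    (h : ∃ n, ∃ q : ℕ → V, q 0 ∈ A ∧ q n ∈ B ∧ (∀ i ≤ n, q i ∈ X) ∧
      ∀ i < n, T.Adj (q i) (q (i + 1))) :
    ∃ n, ∃ q : ℕ → V, 1 ≤ n ∧ T.IsPathSeq n q ∧ q 0 ∈ A ∧ q n ∈ B ∧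
      ∀ i, 0 < i → i < n → q i ∈ X ∧ q i ∉ A ∧ q i ∉ B := by
  classical
  obtain ⟨q, q0, qn, qX, qadj⟩ := Nat.find_spec h
  have hmin := fun m => Nat.find_min h (m := m)
  set n := Nat.find h
  have hn : 1 ≤ n := by
    rcases Nat.eq_zero_or_pos n with h0 | h0
    · rw [h0] at qn
      exact (Set.disjoint_left.1 hAB q0 qn).elim
    · exact h0
  -- a walk that jumps from position `i` to position `j`
  have jump : ∀ i j, i + 2 ≤ j → j ≤ n → ¬ T.Adj (q i) (q j) := by
    intro i j hij hj hadj
    refine hmin (n - (j - i - 1)) (by omega)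
      ⟨fun k => if k ≤ i then q k else q (k + (j - i - 1)), by simpa using q0, ?_, ?_, ?_⟩
    · simp only []
      rw [if_neg (by omega), show n - (j - i - 1) + (j - i - 1) = n by omega]
      exact qn
    · intro k hk
      simp only []
      split_ifs
      · exact qX _ (by omega)
      · exact qX _ (by omega)
    · intro k hk
      simp only []
      by_cases h1 : k + 1 ≤ i
      · rw [if_pos (by omega), if_pos h1]
        exact qadj k (by omega)
      · by_cases h2 : k = i
        · subst h2
          rw [if_pos le_rfl, if_neg h1, show k + 1 + (j - k - 1) = j by omega]
          exact hadj
        · rw [if_neg (by omega), if_neg h1, show k + 1 + (j - i - 1) = k + (j - i - 1) + 1 by omega]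
          exact qadj _ (by omega)
  have hA : ∀ i, 0 < i → i < n → q i ∉ A := fun i h0 hi hA =>
    hmin (n - i) (by omega) ⟨fun k => q (i + k), hA, by
      simp only []
      rwa [show i + (n - i) = n by omega], fun k hk => qX _ (by omega),
      fun k hk => qadj (i + k) (by omega)⟩
  have hB : ∀ i, 0 < i → i < n → q i ∉ B := fun i h0 hi hB =>
    hmin i hi ⟨q, q0, hB, fun k hk => qX _ (by omega), fun k hk => qadj k (by omega)⟩
  refine ⟨n, q, hn, ⟨qadj, fun i j hij hj => antiAdj_of_not_adj (fun heq => ?_) (jump i j hij hj)⟩,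
    q0, qn, fun i h0 hi => ⟨qX i hi.le, hA i h0 hi, hB i h0 hi⟩⟩
  -- A repeated vertex also gives a shortcut: to the successor of its second occurrence or, if that
  -- is the last position, to an earlier visit to `B`.
  rcases hj.eq_or_lt with rfl | hj'
  · rcases Nat.eq_zero_or_pos i with rfl | hi
    · exact Set.disjoint_left.1 hAB q0 (heq ▸ qn)
    · exact hB i hi (by omega) (heq ▸ qn)
  · exact jump i (j + 1) (by omega) (by omega) (heq ▸ qadj j hj')

theorem IsConnected.insert {K : Set V} (hK : T.IsConnected K) {u w : V} (hu : u ∈ K)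
    (h : T.Adj u w) : T.IsConnected (insert w K) := by
  have h2 : (T.fullRealization.induce ({u, w} : Set V)).Connected :=
    SimpleGraph.induce_pair_connected_of_adj h
  have := (SimpleGraph.induce_union_connected hK h2.preconnected ⟨u, hu, by simp⟩).preconnected
  rwa [show K ∪ {u, w} = Insert.insert w K by
    ext x
    simp only [Set.mem_union, Set.mem_insert_iff, Set.mem_singleton_iff]
    constructor
    · rintro (hx | rfl | rfl) <;> simp [*]
    · tauto] at this

/-- By maximality. This lets components be treated as sets closed under adjacency in `X`, the form
in which the cutset arguments are stated. -/
theorem IsComponent.mem_of_adj {X K : Set V} (hK : T.IsComponent X K) {u w : V} (hu : u ∈ K)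
    (hw : w ∈ X) (h : T.Adj u w) : w ∈ K := by
  obtain ⟨hne, hsub, hc⟩ := hK.prop
  exact hK.le_of_ge ⟨⟨w, Set.mem_insert _ _⟩, Set.insert_subset hw hsub, hc.insert hu h⟩
    (Set.subset_insert _ _) (Set.mem_insert _ _)

/-! ### Symmetries and elementary properties of splits -/

namespace IsTwoJoinSplit

variable {X A B C : Fin 2 → Set V}

/-- Exchange of the two sides. -/
theorem flip (h : T.IsTwoJoinSplit X A B C) :
    T.IsTwoJoinSplit (X ∘ Fin.rev) (A ∘ Fin.rev) (B ∘ Fin.rev) (C ∘ Fin.rev) where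
  cover := by rw [Set.union_comm]; exact h.cover
  disjoint_sides := h.disjoint_sides.symm
  side_eq i := h.side_eq _
  disjoint_AB i := h.disjoint_AB _
  disjoint_AC i := h.disjoint_AC _
  disjoint_BC i := h.disjoint_BC _
  nonempty_A i := h.nonempty_A _
  nonempty_B i := h.nonempty_B _
  no_switchable u hu v hv huv := h.no_switchable v hv u hu huv.symm
  strong_A u hu v hv := (h.strong_A v hv u hu).symm
  strong_B u hu v hv := (h.strong_B v hv u hu).symm
  no_other u hu v hv huv := (h.no_other v hv u hu huv.symm).imp And.symm And.symm
  three_le i := h.three_le _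
  not_path i := h.not_path _

/-- Exchange of the sets `A i` and `B i`. -/
theorem swap (h : T.IsTwoJoinSplit X A B C) : T.IsTwoJoinSplit X B A C where
  cover := h.cover
  disjoint_sides := h.disjoint_sides
  side_eq i := by rw [h.side_eq, Set.union_comm (A i)]
  disjoint_AB i := (h.disjoint_AB i).symm
  disjoint_AC := h.disjoint_BC
  disjoint_BC := h.disjoint_AC
  nonempty_A := h.nonempty_B
  nonempty_B := h.nonempty_A
  no_switchable := h.no_switchable
  strong_A := h.strong_B
  strong_B := h.strong_A
  no_other u hu v hv huv := (h.no_other u hu v hv huv).symm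
  three_le := h.three_le
  not_path := by
    rintro i ⟨a, c, b, ha, hb, hX, hac, hcb, hab⟩
    refine h.not_path i ⟨b, c, a, hb, ha, ?_, hcb.symm, hac.symm, fun h => hab h.symm⟩
    rw [hX]
    ext x
    simp only [Set.mem_insert_iff, Set.mem_singleton_iff]
    tauto

theorem mem_cases (h : T.IsTwoJoinSplit X A B C) (v : V) :
    v ∈ A 0 ∨ v ∈ B 0 ∨ v ∈ C 0 ∨ v ∈ A 1 ∨ v ∈ B 1 ∨ v ∈ C 1 := by
  have hv : v ∈ X 0 ∪ X 1 := h.cover ▸ Set.mem_univ v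
  simp only [h.side_eq, Set.mem_union] at hv
  tauto

theorem mem_side (h : T.IsTwoJoinSplit X A B C) (i : Fin 2) (v : V) :
    v ∈ X i ↔ v ∈ A i ∨ v ∈ B i ∨ v ∈ C i := by
  rw [h.side_eq]
  simp only [Set.mem_union, or_assoc]

theorem not_mem_other (h : T.IsTwoJoinSplit X A B C) {v : V} : v ∈ X 0 → v ∉ X 1 :=
  fun h0 => Set.disjoint_left.1 h.disjoint_sides h0

theorem not_mem_AB (h : T.IsTwoJoinSplit X A B C) {i : Fin 2} {v : V} : v ∈ A i → v ∉ B i :=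
  fun h0 => Set.disjoint_left.1 (h.disjoint_AB i) h0

theorem not_mem_AC (h : T.IsTwoJoinSplit X A B C) {i : Fin 2} {v : V} : v ∈ A i → v ∉ C i :=
  fun h0 => Set.disjoint_left.1 (h.disjoint_AC i) h0

theorem not_mem_BC (h : T.IsTwoJoinSplit X A B C) {i : Fin 2} {v : V} : v ∈ B i → v ∉ C i :=
  fun h0 => Set.disjoint_left.1 (h.disjoint_BC i) h0

theorem mem_or (h : T.IsTwoJoinSplit X A B C) (v : V) : v ∈ X 0 ∨ v ∈ X 1 := by
  rw [← Set.mem_union, h.cover]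
  trivial

theorem mem_of_mem_A (h : T.IsTwoJoinSplit X A B C) {i : Fin 2} {v : V} (hv : v ∈ A i) : v ∈ X i :=
  (h.mem_side i v).2 (Or.inl hv)

theorem mem_of_mem_B (h : T.IsTwoJoinSplit X A B C) {i : Fin 2} {v : V} (hv : v ∈ B i) : v ∈ X i :=
  (h.mem_side i v).2 (Or.inr (Or.inl hv))

/-- Adjacent vertices on different sides both lie in the `A`-parts or both in the `B`-parts. -/
theorem adj_cross (h : T.IsTwoJoinSplit X A B C) {u v : V} (hu : u ∈ X 0) (hv : v ∈ X 1)
    (huv : T.Adj u v) : u ∈ A 0 ∧ v ∈ A 1 ∨ u ∈ B 0 ∧ v ∈ B 1 :=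
  h.no_other u hu v hv (huv.resolve_right (h.no_switchable u hu v hv))

theorem ne_cross (h : T.IsTwoJoinSplit X A B C) {u v : V} (hu : u ∈ X 0) (hv : v ∈ X 1) :
    u ≠ v := by
  rintro rfl
  exact h.not_mem_other hu hv

theorem antiAdj_cross (h : T.IsTwoJoinSplit X A B C) {u v : V} (hu : u ∈ X 0) (hv : v ∈ X 1)
    (hA : ¬ (u ∈ A 0 ∧ v ∈ A 1)) (hB : ¬ (u ∈ B 0 ∧ v ∈ B 1)) : T.AntiAdj u v :=
  antiAdj_of_not_adj (h.ne_cross hu hv) fun huv => (h.adj_cross hu hv huv).elim hA hB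

end IsTwoJoinSplit

/-! ### Star cutsets -/

/-- In a path of length at least three, no interior vertex is strongly adjacent to both ends. -/
theorem IsPathSeq.not_strongAdj_ends {n : ℕ} {q : ℕ → V} (hq : T.IsPathSeq n q) (hn : 3 ≤ n)
    {i : ℕ} (hi : i ≤ n) (h₀ : T.StrongAdj (q 0) (q i)) (h₁ : T.StrongAdj (q n) (q i)) :
    False := by
  by_cases h : 2 ≤ i
  · exact h₀.not_antiAdj (hq.antiAdj 0 i (by omega) hi)
  · exact h₁.symm.not_antiAdj (hq.antiAdj i n (by omega) le_rfl)

/-- In an antipath of length at least five, the ends are adjacent, and each has a neighbour and an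
antineighbour in the interior. -/
theorem antipath_ends {n : ℕ} {q : ℕ → V} (hq : T.compl.IsPathSeq n q) (hn : 5 ≤ n) {S : Set V}
    (hS : ∀ i, 0 < i → i < n → q i ∈ S) :
    T.Adj (q 0) (q n) ∧ (∃ s ∈ S, T.Adj (q 0) s) ∧ (∃ s ∈ S, T.AntiAdj (q 0) s) ∧
      (∃ s ∈ S, T.Adj (q n) s) ∧ (∃ s ∈ S, T.AntiAdj (q n) s) := by
  refine ⟨compl_antiAdj.1 (hq.antiAdj 0 n (by omega) le_rfl),
    ⟨q 2, hS 2 (by omega) (by omega), compl_antiAdj.1 (hq.antiAdj 0 2 (by omega) (by omega))⟩,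
    ⟨q 1, hS 1 (by omega) (by omega), compl_adj.1 (hq.adj 0 (by omega))⟩,
    ⟨q (n - 2), hS _ (by omega) (by omega),
      (compl_antiAdj.1 (hq.antiAdj (n - 2) n (by omega) le_rfl)).symm⟩,
    ⟨q (n - 1), hS _ (by omega) (by omega), ?_⟩⟩
  have := hq.adj (n - 1) (by omega)
  rw [show n - 1 + 1 = n by omega] at this
  exact (compl_adj.1 this).symm

/-- A criterion for the existence of a balanced skew-partition in the case of a star cutset with
centre `v` and leaves `N`. -/
theorem hasBalancedSkewPartition_of_star {v : V} {N : Set V} (hN : N.Nonempty)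
    (hv : ∀ x ∈ N, T.StrongAdj v x) (S : Set V)
    (hS : ∀ u, u ≠ v → u ∉ N → ∀ w, w ≠ v → w ∉ N → u ∈ S → T.Adj u w → w ∈ S)
    (hS₁ : ∃ u, u ≠ v ∧ u ∉ N ∧ u ∈ S) (hS₂ : ∃ w, w ≠ v ∧ w ∉ N ∧ w ∉ S)
    (h₁ : ∀ n q, Odd n → 3 ≤ n → T.IsPathSeq n q → q 0 ∈ N → q n ∈ N →
      (∀ i, 0 < i → i < n → q i ≠ v ∧ q i ∉ N) → False)
    (h₂ : ∀ n q, Odd n → 5 ≤ n → T.compl.IsPathSeq n q → q 0 ≠ v → q 0 ∉ N → q n ≠ v → q n ∉ N →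
      (∀ i, 0 < i → i < n → q i ∈ N) → False) :
    T.HasBalancedSkewPartition := by
  -- The centre is strongly adjacent to all leaves, so it is neither an end of a relevant path nor
  -- an interior vertex of a relevant antipath.
  have mem_of_antiAdj : ∀ x ∈ insert v N, ∀ y ∈ insert v N, T.AntiAdj x y → x ∈ N := by
    rintro x (rfl | hx) y (rfl | hy) hxy
    · exact (hxy.ne rfl).elim
    · exact ((hv y hy).not_antiAdj hxy).elim
    · exact hx
    · exact hx
  obtain ⟨x, hx⟩ := hN
  refine hasBalancedSkewPartition_of (insert v N) S {v} ?_ ?_ ?_ ?_ ⟨v, by simp⟩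
    ⟨x, by simp [hx], (hv x hx).1.symm⟩ ?_ ?_
  · simpa [not_or, and_imp] using hS
  · simpa [not_or, and_assoc] using hS₁
  · simpa [not_or, and_assoc] using hS₂
  · rintro u hu w hw rfl hw1
    exact hv w (hw.resolve_left hw1)
  · intro n q hn h3 hq h0 h1 hint
    have h0n := hq.antiAdj 0 n (by omega) le_rfl
    exact h₁ n q hn h3 hq (mem_of_antiAdj _ h0 _ h1 h0n) (mem_of_antiAdj _ h1 _ h0 h0n.symm)
      fun i hi0 hi => by simpa [not_or] using hint i hi0 hi
  · intro n q hn h5 hq h0 h1 hint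
    simp only [Set.mem_insert_iff, not_or] at h0 h1
    refine h₂ n q hn h5 hq h0.1 h0.2 h1.1 h1.2 fun i hi0 hi => ?_
    by_cases h : i + 1 < n
    · exact mem_of_antiAdj _ (hint i hi0 hi) _ (hint (i + 1) (by omega) h)
        (compl_adj.1 (hq.adj i hi))
    · have := (compl_adj.1 (hq.adj (i - 1) (by omega))).symm
      rw [show i - 1 + 1 = i by omega] at this
      exact mem_of_antiAdj _ (hint i hi0 hi) _ (hint (i - 1) (by omega) (by omega)) this

/-- A balanced skew-partition from a cutset consisting of the ends of a strong edge. -/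
theorem hasBalancedSkewPartition_of_strongAdj {u v : V} (huv : T.StrongAdj u v)
    (S : Set V) (hS : ∀ x, x ≠ u → x ≠ v → ∀ y, y ≠ u → y ≠ v → x ∈ S → T.Adj x y → y ∈ S)
    (hS₁ : ∃ x, x ≠ u ∧ x ≠ v ∧ x ∈ S) (hS₂ : ∃ x, x ≠ u ∧ x ≠ v ∧ x ∉ S) :
    T.HasBalancedSkewPartition := by
  refine hasBalancedSkewPartition_of_star (v := u) (N := {v}) ⟨v, rfl⟩ (by simpa using huv) S hS
    hS₁ hS₂ ?_ ?_
  · exact fun n q hn h3 hq h0 h1 _ =>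
      (hq.antiAdj 0 n (by omega) le_rfl).ne (h0.trans (Eq.symm h1))
  · exact fun n q hn h5 hq _ _ _ _ h => (compl_adj.1 (hq.adj 1 (by omega))).ne
      ((h 1 (by omega) (by omega)).trans (Eq.symm (h 2 (by omega) (by omega))))

/-! ### Components of a side, and paths across it -/

namespace IsTwoJoinSplit

variable {X A B C : Fin 2 → Set V}

/-- A union of components of `T|X 0` that misses `B 0` yields a balanced skew-partition, unless it
consists of the only vertex of `A 0`. -/
theorem eq_singleton_of_closed (h : T.IsTwoJoinSplit X A B C) (hB : T.IsBerge)
    (hT : ¬ T.HasBalancedSkewPartition) {K : Set V} (hKX : K ⊆ X 0)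
    (hK : ∀ u ∈ K, ∀ w ∈ X 0, T.Adj u w → w ∈ K) (hne : K.Nonempty) (hKB : ∀ u ∈ K, u ∉ B 0) :
    ∃ a, A 0 = {a} ∧ K = {a} := by
  obtain ⟨b, hb⟩ := h.nonempty_B 0
  obtain ⟨a₁, ha₁⟩ := h.nonempty_A 1
  have hcov := h.mem_cases
  have hX0 := h.mem_side 0
  have hX1 := h.mem_side 1
  have hbK : b ∉ K := fun hbK => hKB b hbK hb
  -- The only edges leaving `K` join `K ∩ A 0` to `A 1`.
  have hKcross : ∀ u ∈ K, ∀ w, T.Adj u w → w ∈ K ∨ u ∈ A 0 ∧ w ∈ A 1 := by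
    intro u hu w huw
    by_cases hw : w ∈ X 0
    · exact Or.inl (hK u hu w hw huw)
    · have hw1 : w ∈ X 1 := by
        have := hcov w
        grind
      rcases h.adj_cross (hKX hu) hw1 huw with h' | h'
      · exact Or.inr h'
      · exact (hKB u hu h'.1).elim
  have ha₁X : a₁ ∈ X 1 := (hX1 _).2 (Or.inl ha₁)
  have hbX : b ∈ X 0 := (hX0 _).2 (Or.inr (Or.inl hb))
  have ha₁K : a₁ ∉ K := fun h' => h.not_mem_other (hKX h') ha₁X
  by_cases hKA : ∀ u ∈ K, u ∉ A 0
  · obtain ⟨a, ha⟩ := h.nonempty_A 0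
    refine (hT (hasBalancedSkewPartition_of_strongAdj (h.strong_A a ha a₁ ha₁) K ?_ ?_ ?_)).elim
    · intro x _ _ y _ _ hx hxy
      exact (hKcross x hx y hxy).resolve_right fun h' => hKA x hx h'.1
    · obtain ⟨x, hx⟩ := hne
      exact ⟨x, by rintro rfl; exact hKA x hx ha, by rintro rfl; exact ha₁K hx, hx⟩
    · exact ⟨b, by rintro rfl; exact h.not_mem_AB ha hb, h.ne_cross hbX ha₁X, hbK⟩
  push Not at hKA
  obtain ⟨a, haK, ha⟩ := hKA
  by_cases hKC : ∃ c ∈ K, c ∈ C 0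
  · obtain ⟨c, hcK, hc⟩ := hKC
    have hcA : ∀ u ∈ C 0, u ∉ A 0 := fun u hu hA => h.not_mem_AC hA hu
    have hstr : ∀ x ∈ A 0, T.StrongAdj a₁ x := fun x hx => (h.strong_A x hx a₁ ha₁).symm
    have hanti : ∀ u ∈ K, u ∉ A 0 → T.AntiAdj a₁ u := fun u hu hA =>
      (h.antiAdj_cross (hKX hu) ha₁X (fun h' => hA h'.1) (fun h' => hKB u hu h'.1)).symm
    refine (hT (hasBalancedSkewPartition_of_star (v := a₁) (N := K ∩ A 0) ⟨a, haK, ha⟩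
      (fun x hx => hstr x hx.2) K ?_ ⟨c, ?_, fun h' => hcA c hc h'.2, hcK⟩
      ⟨b, h.ne_cross hbX ha₁X, fun h' => hbK h'.1, hbK⟩ ?_ ?_)).elim
    · intro u _ hu w _ hw huK huw
      exact (hKcross u huK w huw).resolve_right fun h' => hu ⟨huK, h'.1⟩
    · rintro rfl
      exact ha₁K hcK
    · intro n q hn h3 hq h0 h1 hint
      have hmem : ∀ i, 0 < i → i < n → q i ∈ K := by
        refine hq.interior_mem (P := (· ∈ K)) ?_ ?_
        · refine (hKcross _ h0.1 _ (hq.adj 0 (by omega))).resolve_right fun h' => ?_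
          exact hq.not_strongAdj_ends h3 (i := 1) (by omega) (h.strong_A _ h0.2 _ h'.2)
            (h.strong_A _ h1.2 _ h'.2)
        · intro i hi0 hi hiK hadj
          exact (hKcross _ hiK _ hadj).resolve_right fun h' =>
            (hint i hi0 (by omega)).2 ⟨hiK, h'.1⟩
      refine Nat.not_even_iff_odd.2 hn (hB.even_of_center hq (by omega) (hstr _ h0.2).adj
        (hstr _ h1.2).adj fun i hi0 hi => ?_)
      exact hanti _ (hmem i hi0 hi) fun h' => (hint i hi0 hi).2 ⟨hmem i hi0 hi, h'⟩
    · intro n q hn h5 hq _ h0 _ h1 hint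
      obtain ⟨-, ⟨s, hs, hs'⟩, ⟨t, ht, ht'⟩, ⟨u, hu, hu'⟩, ⟨v, hv, hv'⟩⟩ :=
        antipath_ends hq h5 hint
      have key : ∀ x s t, s ∈ K ∩ A 0 → t ∈ K ∩ A 0 → T.Adj x s → T.AntiAdj x t →
          x ∉ K ∩ A 0 → T.AntiAdj a₁ x := by
        intro x s t hs ht hxs hxt hx
        have hxK : x ∈ K := (hKcross s hs.1 x hxs.symm).resolve_right fun h' =>
          (h.strong_A t ht.2 x h'.2).not_antiAdj hxt.symm
        exact hanti x hxK fun h' => hx ⟨hxK, h'⟩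
      exact Nat.not_even_iff_odd.2 hn (hB.even_of_center_compl hq (by omega)
        (key _ s t hs ht hs' ht' h0) (key _ u v hu hv hu' hv' h1)
        fun i hi0 hi => (hstr _ (hint i hi0 hi).2).adj)
  · push Not at hKC
    have hKA : K ⊆ A 0 := fun u hu => by
      have := (hX0 u).1 (hKX hu)
      have := hKB u hu
      have := hKC u hu
      tauto
    by_cases hA : A 0 = {a}
    · exact ⟨a, hA, Set.Subset.antisymm (hA ▸ hKA) (by simpa using haK)⟩
    -- A second vertex `a'` of `A 0` is the centre of a star with leaves `A 1` that separates `a`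
    -- from `b`. The vertex closing holes and antiholes is `a`, whose neighbours all lie in `A 0 ∪ A
    -- 1`.
    · obtain ⟨a', ha', haa'⟩ : ∃ a' ∈ A 0, a' ≠ a := by
        by_contra! hcon
        exact hA (Set.eq_singleton_iff_unique_mem.2 ⟨ha, hcon⟩)
      have hanti : ∀ x, x ∉ A 0 → x ∉ A 1 → T.AntiAdj a x := fun x h0 h1 =>
        antiAdj_of_not_adj (by rintro rfl; exact h0 ha) fun h' =>
          (hKcross a haK x h').elim (fun h' => h0 (hKA h')) fun h' => h1 h'.2
      have haA1 : a ∉ A 1 := fun h' => h.ne_cross ((hX0 _).2 (Or.inl ha))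
        ((hX1 _).2 (Or.inl h')) rfl
      have ha'str : ∀ x ∈ A 1, T.StrongAdj a' x := fun x hx => h.strong_A a' ha' x hx
      refine (hT (hasBalancedSkewPartition_of_star (v := a') (N := A 1) ⟨a₁, ha₁⟩ ha'str K ?_
        ⟨a, haa'.symm, haA1, haK⟩ ⟨b, ?_, fun h' => h.ne_cross hbX ((hX1 _).2 (Or.inl h')) rfl, hbK⟩
        ?_ ?_)).elim
      · intro u _ _ w _ hw huK huw
        exact (hKcross u huK w huw).resolve_right fun h' => hw h'.2
      · rintro rfl
        exact h.not_mem_AB ha' hb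
      · intro n q hn h3 hq h0 h1 hint
        refine Nat.not_even_iff_odd.2 hn (hB.even_of_center hq (by omega)
          (h.strong_A a ha _ h0).adj (h.strong_A a ha _ h1).adj fun i hi0 hi => ?_)
        refine hanti _ (fun h' => ?_) (hint i hi0 hi).2
        exact hq.not_strongAdj_ends h3 hi.le (h.strong_A _ h' _ h0).symm
          (h.strong_A _ h' _ h1).symm
      · intro n q hn h5 hq _ h0 _ h1 hint
        obtain ⟨-, -, ⟨t, ht, ht'⟩, -, ⟨v, hv, hv'⟩⟩ := antipath_ends hq h5 hint
        have key : ∀ x t, t ∈ A 1 → T.AntiAdj x t → x ∉ A 1 → T.AntiAdj a x :=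
          fun x t ht hxt hx => hanti x (fun h' => (h.strong_A x h' t ht).not_antiAdj hxt) hx
        exact Nat.not_even_iff_odd.2 hn (hB.even_of_center_compl hq (by omega)
          (key _ t ht ht' h0) (key _ v hv hv' h1)
          fun i hi0 hi => (h.strong_A a ha _ (hint i hi0 hi)).adj)

/-- Every nonempty union of components of `T|X 0` meets `B 0`. -/
theorem exists_mem_B_of_closed (h : T.IsTwoJoinSplit X A B C) (hB : T.IsBerge)
    (hT : ¬ T.HasBalancedSkewPartition) {K : Set V} (hKX : K ⊆ X 0)
    (hK : ∀ u ∈ K, ∀ w ∈ X 0, T.Adj u w → w ∈ K) (hne : K.Nonempty) :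
    (K ∩ B 0).Nonempty := by
  by_contra hcon
  obtain ⟨a, hA, rfl⟩ := h.eq_singleton_of_closed hB hT hKX hK hne
    fun u hu hub => hcon ⟨u, hu, hub⟩
  have ha : a ∈ A 0 := hA ▸ rfl
  obtain ⟨b, hb⟩ := h.nonempty_B 0
  have hab : b ≠ a := by
    rintro rfl
    exact h.not_mem_AB ha hb
  -- The rest of the side is again closed and misses `A 0`, so it too is a single vertex, and the
  -- side has only two.
  obtain ⟨b', -, hb'⟩ := h.swap.eq_singleton_of_closed hB hT (K := X 0 \ {a}) Set.sdiff_subset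
    (fun u hu w hw huw => ⟨hw, fun hwa => hu.2
      (hK w hwa u hu.1 huw.symm)⟩)
    ⟨b, (h.mem_side 0 b).2 (Or.inr (Or.inl hb)), hab⟩ (fun u hu hua => hu.2 (hA ▸ hua))
  have h3 := h.three_le 0
  have : X 0 ⊆ {a, b'} := fun x hx => by
    by_cases hxa : x = a
    · exact Or.inl hxa
    · exact Or.inr (hb' ▸ (⟨hx, hxa⟩ : x ∈ X 0 \ {a}))
  have := Set.ncard_le_ncard this
  have := Set.ncard_insert_le a {b'}
  rw [Set.ncard_singleton] at this
  omega

/-- There is a path in `T|X 0` from `A 0` to `B 0` with interior in `C 0`. -/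
theorem exists_isPathSeq (h : T.IsTwoJoinSplit X A B C) (hB : T.IsBerge)
    (hT : ¬ T.HasBalancedSkewPartition) :
    ∃ n, ∃ q : ℕ → V, 1 ≤ n ∧ T.IsPathSeq n q ∧ q 0 ∈ A 0 ∧ q n ∈ B 0 ∧
      ∀ i, 0 < i → i < n → q i ∈ C 0 := by
  obtain ⟨a, ha⟩ := h.nonempty_A 0
  have haX := (h.mem_side 0 a).2 (Or.inl ha)
  -- The vertices reachable from `A 0` inside `X 0`: a closed set, so it meets `B 0`.
  let K : Set V := {w | ∃ n, ∃ q : ℕ → V, q 0 ∈ A 0 ∧ q n = w ∧ (∀ i ≤ n, q i ∈ X 0) ∧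
      ∀ i < n, T.Adj (q i) (q (i + 1))}
  obtain ⟨b, ⟨n, q, q0, rfl, qX, qadj⟩, hb⟩ := h.exists_mem_B_of_closed hB hT (K := K)
    (by rintro w ⟨n, q, -, rfl, qX, -⟩; exact qX n le_rfl)
    (by
      rintro u ⟨n, q, q0, rfl, qX, qadj⟩ w hw huw
      refine ⟨n + 1, fun i => if i ≤ n then q i else w, by simpa using q0, by simp,
        fun i hi => ?_, fun i hi => ?_⟩
      · simp only []
        split_ifs with h'
        · exact qX i h'
        · exact hw
      · simp only []
        rw [if_pos (by omega)]
        split_ifs with h'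
        · exact qadj i (by omega)
        · rwa [show i = n by omega])
    ⟨a, 0, fun _ => a, ha, rfl, fun _ _ => haX, fun i hi => by omega⟩
  obtain ⟨m, r, hm, hr, r0, rm, hint⟩ := exists_isPathSeq_of_walk (T := T) (h.disjoint_AB 0)
    ⟨n, q, q0, hb, qX, qadj⟩
  refine ⟨m, r, hm, hr, r0, rm, fun i h0 hi => ?_⟩
  obtain ⟨h1, h2, h3⟩ := hint i h0 hi
  have := (h.mem_side 0 _).1 h1
  tauto

/-- Paths on both sides from the `A`-part to the `B`-part through the `C`-part have lengths of the
same parity. -/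
theorem even_add (h : T.IsTwoJoinSplit X A B C) (hB : T.IsBerge) {s t : ℕ} {p q : ℕ → V}
    (hs : 1 ≤ s) (ht : 1 ≤ t) (hp : T.IsPathSeq s p) (hq : T.IsPathSeq t q)
    (hp0 : p 0 ∈ A 0) (hps : p s ∈ B 0) (hpi : ∀ i, 0 < i → i < s → p i ∈ C 0)
    (hq0 : q 0 ∈ A 1) (hqt : q t ∈ B 1) (hqi : ∀ i, 0 < i → i < t → q i ∈ C 1) :
    Even (s + t) := by
  have hpX : ∀ i ≤ s, p i ∈ X 0 ∧ (i ≠ 0 → p i ∉ A 0) ∧ (i ≠ s → p i ∉ B 0) := by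
    intro i hi
    rw [h.mem_side]
    have : i = 0 ∨ i = s ∨ 0 < i ∧ i < s := by omega
    rcases this with rfl | rfl | ⟨h1, h2⟩
    · exact ⟨Or.inl hp0, by simp, fun _ => h.not_mem_AB hp0⟩
    · exact ⟨Or.inr (Or.inl hps), fun _ h' => h.not_mem_AB h' hps, by simp⟩
    · exact ⟨Or.inr (Or.inr (hpi i h1 h2)), fun _ h' => h.not_mem_AC h' (hpi i h1 h2),
        fun _ h' => h.not_mem_BC h' (hpi i h1 h2)⟩
  have hqX : ∀ i ≤ t, q i ∈ X 1 ∧ (i ≠ 0 → q i ∉ A 1) ∧ (i ≠ t → q i ∉ B 1) := by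
    intro i hi
    rw [h.mem_side]
    have : i = 0 ∨ i = t ∨ 0 < i ∧ i < t := by omega
    rcases this with rfl | rfl | ⟨h1, h2⟩
    · exact ⟨Or.inl hq0, by simp, fun _ => h.not_mem_AB hq0⟩
    · exact ⟨Or.inr (Or.inl hqt), fun _ h' => h.not_mem_AB h' hqt, by simp⟩
    · exact ⟨Or.inr (Or.inr (hqi i h1 h2)), fun _ h' => h.not_mem_AC h' (hqi i h1 h2),
        fun _ h' => h.not_mem_BC h' (hqi i h1 h2)⟩
  have hq' := hq.reverse
  refine hB.even_of_isPathSeq_of_isPathSeq hp hq' (by omega) ?_ ?_ ?_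
  · simpa using (h.strong_B _ hps _ hqt).adj
  · simpa using (h.strong_A _ hp0 _ hq0).adj
  · intro i hi j hj h1 h2
    obtain ⟨a1, a2, a3⟩ := hpX i hi
    obtain ⟨b1, b2, b3⟩ := hqX (t - j) (by omega)
    refine h.antiAdj_cross a1 b1 ?_ ?_
    · rintro ⟨c1, c2⟩
      have : i = 0 := by
        by_contra h'
        exact a2 h' c1
      exact b2 (by omega) c2
    · rintro ⟨c1, c2⟩
      have : i = s := by
        by_contra h'
        exact a3 h' c1
      exact b3 (by omega) c2

theorem antiAdj_of_mem_A_one (h : T.IsTwoJoinSplit X A B C) {a x : V} (ha : a ∈ A 1)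
    (hx : x ∈ X 0) (hxA : x ∉ A 0) : T.AntiAdj a x :=
  (h.antiAdj_cross hx (h.mem_of_mem_A ha) (fun h' => hxA h'.1)
    (fun h' => h.not_mem_AB ha h'.2)).symm

theorem antiAdj_of_mem_B_one (h : T.IsTwoJoinSplit X A B C) {b x : V} (hb : b ∈ B 1)
    (hx : x ∈ X 0) (hxB : x ∉ B 0) : T.AntiAdj b x :=
  h.swap.antiAdj_of_mem_A_one hb hx hxB

theorem antiAdj_of_mem_A_zero (h : T.IsTwoJoinSplit X A B C) {a x : V} (ha : a ∈ A 0)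
    (hx : x ∈ X 1) (hxA : x ∉ A 1) : T.AntiAdj a x :=
  h.flip.antiAdj_of_mem_A_one ha hx hxA

theorem antiAdj_of_mem_B_zero (h : T.IsTwoJoinSplit X A B C) {b x : V} (hb : b ∈ B 0)
    (hx : x ∈ X 1) (hxB : x ∉ B 1) : T.AntiAdj b x :=
  h.flip.antiAdj_of_mem_B_one hb hx hxB

/-! ### Antineighbours across a side -/

/-- If `X 0` consists of `B 0` and one vertex strongly complete to `B 0`, then there is a balanced
skew-partition. -/
theorem hasBalancedSkewPartition_of_subset_insert (h : T.IsTwoJoinSplit X A B C) (hB : T.IsBerge)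
    {a : V} (ha : a ∈ A 0) (hab : ∀ b ∈ B 0, T.StrongAdj a b)
    (hX : ∀ x ∈ X 0, x = a ∨ x ∈ B 0) : T.HasBalancedSkewPartition := by
  obtain ⟨b, hb⟩ := h.nonempty_B 0
  obtain ⟨b', hb', hbb'⟩ : ∃ b' ∈ B 0, b' ≠ b := by
    by_contra! hcon
    have : X 0 ⊆ {a, b} := fun x hx => (hX x hx).imp id (hcon x)
    have := Set.ncard_le_ncard this
    have := Set.ncard_insert_le a {b}
    rw [Set.ncard_singleton] at this
    have := h.three_le 0
    omega
  obtain ⟨a₁, ha₁⟩ := h.nonempty_A 1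
  have hstr : ∀ u ∈ B 0, ∀ x ∈ insert a (B 1), T.StrongAdj u x := by
    rintro u hu x (rfl | hx)
    · exact (hab u hu).symm
    · exact h.strong_B u hu x hx
  have haB : a ∉ B 0 := h.not_mem_AB ha
  have hout : ∀ x, x ∉ B 0 → x ∉ insert a (B 1) → T.AntiAdj b x := by
    intro x hx hxN
    rcases h.mem_or x with h0 | h1
    · exact (hxN (((hX x h0).resolve_right hx) ▸ Set.mem_insert _ _)).elim
    · exact h.antiAdj_of_mem_B_zero hb h1 fun h' => hxN (Set.mem_insert_of_mem _ h')
  -- This star separates the rest of `B 0` from `A 1`. All of `B 0` is strongly complete to the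
  -- leaves, so path interiors and antipath ends avoid `B 0`, and the centre itself closes the hole
  -- or antihole.
  refine hasBalancedSkewPartition_of_star (v := b) (N := insert a (B 1)) ⟨a, Set.mem_insert _ _⟩
    (hstr b hb) (B 0) ?_ ⟨b', hbb', ?_, hb'⟩ ⟨a₁, ?_, ?_, ?_⟩ ?_ ?_
  · intro u _ _ w _ hw hu huw
    rcases h.mem_or w with h0 | h1
    · exact (hX w h0).resolve_left fun h' => hw (h' ▸ Set.mem_insert _ _)
    · rcases h.adj_cross (h.mem_of_mem_B hu) h1 huw with h' | h'
      · exact (h.not_mem_AB h'.1 hu).elim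
      · exact (hw (Set.mem_insert_of_mem _ h'.2)).elim
  · rintro (rfl | h')
    · exact haB hb'
    · exact h.ne_cross (h.mem_of_mem_B hb') (h.mem_of_mem_B h') rfl
  · exact (h.ne_cross (h.mem_of_mem_B hb) (h.mem_of_mem_A ha₁)).symm
  · rintro (rfl | h')
    · exact h.ne_cross (h.mem_of_mem_A ha) (h.mem_of_mem_A ha₁) rfl
    · exact h.not_mem_AB ha₁ h'
  · exact fun h' => h.ne_cross (h.mem_of_mem_B h') (h.mem_of_mem_A ha₁) rfl
  · intro n q hn h3 hq h0 h1 hint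
    refine Nat.not_even_iff_odd.2 hn (hB.even_of_center hq (by omega)
      (hstr b hb _ h0).adj (hstr b hb _ h1).adj fun i hi0 hi => hout _ (fun h' => ?_)
        (hint i hi0 hi).2)
    exact hq.not_strongAdj_ends h3 hi.le (hstr _ h' _ h0).symm (hstr _ h' _ h1).symm
  · intro n q hn h5 hq _ h0 _ h1 hint
    obtain ⟨-, -, ⟨t, ht, ht'⟩, -, ⟨v, hv, hv'⟩⟩ := antipath_ends hq h5 hint
    exact Nat.not_even_iff_odd.2 hn (hB.even_of_center_compl hq (by omega)
      (hout _ (fun h' => (hstr _ h' t ht).not_antiAdj ht') h0)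
      (hout _ (fun h' => (hstr _ h' v hv).not_antiAdj hv') h1)
      fun i hi0 hi => (hstr b hb _ (hint i hi0 hi)).adj)

/-- Every vertex of `A 0` has an antineighbour in `B 0`. -/
theorem exists_antiAdj (h : T.IsTwoJoinSplit X A B C) (hB : T.IsBerge)
    (hT : ¬ T.HasBalancedSkewPartition) {a : V} (ha : a ∈ A 0) : ∃ b ∈ B 0, T.AntiAdj a b := by
  by_contra! hcon
  have hab : ∀ b ∈ B 0, T.StrongAdj a b := fun b hb => by
    by_contra h'
    exact hcon b hb (antiAdj_of_not_strongAdj (by rintro rfl; exact h.not_mem_AB ha hb) h')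
  -- The star with centre `a` and leaves `B 0 ∪ A 1` separates the two sides, provided that it
  -- leaves a vertex of `X 0`; otherwise the preceding construction applies.
  by_cases hX : ∀ x ∈ X 0, x = a ∨ x ∈ B 0
  · exact hT (h.hasBalancedSkewPartition_of_subset_insert hB ha hab hX)
  push Not at hX
  obtain ⟨x, hx, hxa, hxB⟩ := hX
  obtain ⟨b₁, hb₁⟩ := h.nonempty_B 1
  obtain ⟨ℓ, r, hℓ, hr, hr0, hrℓ, hri⟩ := h.flip.exists_isPathSeq hB hT
  have hcross : ∀ u ∈ X 0, ∀ w ∈ X 1, u ∉ B 0 → w ∉ A 1 → ¬ T.Adj u w := fun u hu w hw h0 h1 huw =>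
    (h.adj_cross hu hw huw).elim (fun h' => h1 h'.2) fun h' => h0 h'.1
  have hstr : ∀ y ∈ B 0 ∪ A 1, T.StrongAdj a y := by
    rintro y (hy | hy)
    · exact hab y hy
    · exact h.strong_A a ha y hy
  -- Without its first vertex, `q` is a path of even length `n - 1` from `A 0` to `B 0`, while `a`
  -- and `q n` form one of length 1; comparison with `r` on the other side is contradictory.
  have hmixed : ∀ n q, Odd n → 3 ≤ n → T.IsPathSeq n q → q 0 ∈ A 1 → q n ∈ B 0 →
      (∀ i, 0 < i → i < n → q i ∉ B 0) → (∀ i, 0 < i → i < n → q i ∈ X 0) → False := by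
    intro n q hn h3 hq h0 h1 hint hintX
    have hq1 : q 1 ∈ A 0 := by
      rcases h.adj_cross (hintX 1 (by omega) (by omega)) (h.mem_of_mem_A h0)
        (hq.adj 0 (by omega)).symm with h' | h'
      · exact h'.1
      · exact (h.not_mem_AB h0 h'.2).elim
    have e1 := h.even_add hB (s := 1) (p := fun i => if i = 0 then a else q n) le_rfl hℓ
      ⟨fun i hi => by
        obtain rfl : i = 0 := by omega
        simpa using (hab _ h1).adj, fun i j hij hj => by omega⟩ hr (by simpa using ha)
        (by simpa using h1) (fun i h0 h1 => by omega) hr0 hrℓ hri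
    have e2 := h.even_add hB (s := n - 1) (p := fun i => q (1 + i)) (by omega) hℓ
      (hq.sub (by omega)) hr hq1 (by simpa [show 1 + (n - 1) = n by omega] using h1)
      (fun i hi0 hi => by
        have hX := (h.mem_side 0 _).1 (hintX (1 + i) (by omega) (by omega))
        have hB' := hint (1 + i) (by omega) (by omega)
        have hA' : q (1 + i) ∉ A 0 := fun h' => (h.strong_A _ h' _ h0).symm.not_antiAdj
          (hq.antiAdj 0 (1 + i) (by omega) (by omega))
        tauto) hr0 hrℓ hri
    rw [Nat.even_iff] at e1 e2
    rw [Nat.odd_iff] at hn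
    omega
  refine hT (hasBalancedSkewPartition_of_star (v := a) (N := B 0 ∪ A 1) ⟨_, Or.inr hr0⟩ hstr (X 0)
    ?_ ⟨x, hxa, ?_, hx⟩ ⟨b₁, ?_, ?_, ?_⟩ ?_ ?_)
  · intro u _ hu w _ hw hu0 huw
    refine (h.mem_or w).resolve_right fun hw1 => hcross u hu0 w hw1 (fun h' => hu (Or.inl h'))
      (fun h' => hw (Or.inr h')) huw
  · rintro (h' | h')
    · exact hxB h'
    · exact h.ne_cross hx (h.mem_of_mem_A h') rfl
  · exact (h.ne_cross (h.mem_of_mem_A ha) (h.mem_of_mem_B hb₁)).symm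
  · rintro (h' | h')
    · exact h.ne_cross (h.mem_of_mem_B h') (h.mem_of_mem_B hb₁) rfl
    · exact h.not_mem_AB h' hb₁
  · exact fun h' => h.ne_cross h' (h.mem_of_mem_B hb₁) rfl
  · intro n q hn h3 hq h0 h1 hint
    have hintB : ∀ i, 0 < i → i < n → q i ∉ B 0 := fun i hi0 hi h' =>
      (hint i hi0 hi).2 (Or.inl h')
    have hintA : ∀ i, 0 < i → i < n → q i ∉ A 1 := fun i hi0 hi h' =>
      (hint i hi0 hi).2 (Or.inr h')
    rcases h.mem_or (q 1) with hq1 | hq1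
    · have hintX : ∀ i, 0 < i → i < n → q i ∈ X 0 := hq.interior_mem (P := (· ∈ X 0)) hq1
        fun i hi0 hi hiX hadj => (h.mem_or _).resolve_right fun h' =>
          hcross _ hiX _ h' (hintB i hi0 (by omega)) (hintA (i + 1) (by omega) hi) hadj
      rcases h0 with h0 | h0 <;> rcases h1 with h1 | h1
      · exact Nat.not_even_iff_odd.2 hn (hB.even_of_center hq (by omega)
          (h.strong_B _ h0 _ hb₁).adj.symm (h.strong_B _ h1 _ hb₁).adj.symm
          fun i hi0 hi => h.antiAdj_of_mem_B_one hb₁ (hintX i hi0 hi) (hintB i hi0 hi))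
      · exact hmixed n _ hn h3 hq.reverse h1 (by simpa using h0)
          (fun i hi0 hi => hintB _ (by omega) (by omega))
          fun i hi0 hi => hintX _ (by omega) (by omega)
      · exact hmixed n q hn h3 hq h0 h1 hintB hintX
      · rcases h.adj_cross hq1 (h.mem_of_mem_A h0) (hq.adj 0 (by omega)).symm with h' | h'
        · exact hq.not_strongAdj_ends h3 (i := 1) (by omega) (h.strong_A _ h'.1 _ h0).symm
            (h.strong_A _ h'.1 _ h1).symm
        · exact h.not_mem_AB h0 h'.2
    · have hintX : ∀ i, 0 < i → i < n → q i ∈ X 1 := hq.interior_mem (P := (· ∈ X 1)) hq1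
        fun i hi0 hi hiX hadj => (h.mem_or _).resolve_left fun h' =>
          hcross _ h' _ hiX (hintB (i + 1) (by omega) hi) (hintA i hi0 (by omega)) hadj.symm
      exact Nat.not_even_iff_odd.2 hn (hB.even_of_center hq (by omega) (hstr _ h0).adj
        (hstr _ h1).adj fun i hi0 hi =>
          h.antiAdj_of_mem_A_zero ha (hintX i hi0 hi) (hintA i hi0 hi))
  · intro n q hn h5 hq _ h0 _ h1 hint
    -- There are no edges between `B 0` and `A 1`, whereas vertices two or more apart on an antipath
    -- are adjacent. As `n ≥ 5`, positions 1 and 2 can be compared through 4, so the whole interior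
    -- lies in one of the two sets.
    have hsame : ∀ i j, 0 < i → i + 2 ≤ j → j < n → (q i ∈ B 0 ↔ q j ∈ B 0) := by
      intro i j hi hij hj
      have hadj := compl_antiAdj.1 (hq.antiAdj i j hij hj.le)
      have key : ∀ u w, T.Adj u w → u ∈ B 0 → w ∉ A 1 := fun u w huw hu hw =>
        (h.adj_cross (h.mem_of_mem_B hu) (h.mem_of_mem_A hw) huw).elim
          (fun h' => h.not_mem_AB h'.1 hu) fun h' => h.not_mem_AB hw h'.2
      exact ⟨fun h' => (hint j (by omega) hj).resolve_right (key _ _ hadj h'),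
        fun h' => (hint i hi (by omega)).resolve_right (key _ _ hadj.symm h')⟩
    have hsame1 : ∀ i, 0 < i → i < n → (q i ∈ B 0 ↔ q 1 ∈ B 0) := by
      intro i hi0 hi
      have : i = 1 ∨ i = 2 ∨ 3 ≤ i := by omega
      rcases this with rfl | rfl | h'
      · rfl
      · rw [hsame 2 4 (by omega) (by omega) (by omega), hsame 1 4 (by omega) (by omega) (by omega)]
      · exact (hsame 1 i (by omega) (by omega) hi).symm
    by_cases hq1 : q 1 ∈ B 0
    · have hintB : ∀ i, 0 < i → i < n → q i ∈ B 0 := fun i hi0 hi => (hsame1 i hi0 hi).2 hq1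
      obtain ⟨-, ⟨s, hs, hs'⟩, ⟨t, ht, ht'⟩, ⟨u, hu, hu'⟩, ⟨v, hv, hv'⟩⟩ :=
        antipath_ends hq h5 hintB
      have key : ∀ y s t, s ∈ B 0 → t ∈ B 0 → T.Adj y s → T.AntiAdj y t → y ∉ B 0 ∪ A 1 →
          T.AntiAdj b₁ y := by
        intro y s t hs ht hys hyt hy
        refine h.antiAdj_of_mem_B_one hb₁ ((h.mem_or y).resolve_right fun hy1 => ?_)
          fun h' => hy (Or.inl h')
        rcases h.adj_cross (h.mem_of_mem_B hs) hy1 hys.symm with h' | h'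
        · exact h.not_mem_AB h'.1 hs
        · exact (h.strong_B t ht y h'.2).symm.not_antiAdj hyt
      exact Nat.not_even_iff_odd.2 hn (hB.even_of_center_compl hq (by omega)
        (key _ s t hs ht hs' ht' h0) (key _ u v hu hv hu' hv' h1)
        fun i hi0 hi => (h.strong_B _ (hintB i hi0 hi) _ hb₁).adj.symm)
    · have hintA : ∀ i, 0 < i → i < n → q i ∈ A 1 := fun i hi0 hi =>
        (hint i hi0 hi).resolve_left (mt (hsame1 i hi0 hi).1 hq1)
      obtain ⟨-, ⟨s, hs, hs'⟩, ⟨t, ht, ht'⟩, ⟨u, hu, hu'⟩, ⟨v, hv, hv'⟩⟩ :=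
        antipath_ends hq h5 hintA
      have key : ∀ y s t, s ∈ A 1 → t ∈ A 1 → T.Adj y s → T.AntiAdj y t → y ∉ B 0 ∪ A 1 →
          T.AntiAdj a y := by
        intro y s t hs ht hys hyt hy
        refine h.antiAdj_of_mem_A_zero ha ((h.mem_or y).resolve_left fun hy1 => ?_)
          fun h' => hy (Or.inr h')
        rcases h.adj_cross hy1 (h.mem_of_mem_A hs) hys with h' | h'
        · exact (h.strong_A y h'.1 t ht).not_antiAdj hyt
        · exact h.not_mem_AB hs h'.2
      exact Nat.not_even_iff_odd.2 hn (hB.even_of_center_compl hq (by omega)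
        (key _ s t hs ht hs' ht' h0) (key _ u v hu hv hu' hv' h1)
        fun i hi0 hi => (h.strong_A _ ha _ (hintA i hi0 hi)).adj)

/-! ### Neighbours outside the attachment set -/

/-- A path that starts in `A 0`, leaves `X 0` and avoids `A 1` leaves `X 0` from `B 0` to `B 1`. -/
theorem exists_first_exit (h : T.IsTwoJoinSplit X A B C) {n : ℕ} {q : ℕ → V}
    (hq : T.IsPathSeq n q) (h₀ : q 0 ∈ A 0) (hA : ∀ i ≤ n, q i ∉ A 1) (hex : ∃ i ≤ n, q i ∉ X 0) :
    ∃ i, 2 ≤ i ∧ i ≤ n ∧ (∀ k < i, q k ∈ X 0) ∧ q (i - 1) ∈ B 0 ∧ q i ∈ B 1 := by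
  classical
  obtain ⟨hin, hiX⟩ := Nat.find_spec hex
  have hmin := fun m => Nat.find_min hex (m := m)
  set i := Nat.find hex
  have hX : ∀ k < i, q k ∈ X 0 := fun k hk => by
    by_contra h'
    exact hmin k hk ⟨by omega, h'⟩
  have hi0 : i ≠ 0 := fun h' => hiX (h' ▸ h.mem_of_mem_A h₀)
  have hadj := hq.adj (i - 1) (by omega)
  rw [show i - 1 + 1 = i by omega] at hadj
  obtain ⟨-, h1⟩ | ⟨h1, h2⟩ := h.adj_cross (hX (i - 1) (by omega)) ((h.mem_or _).resolve_left hiX)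
    hadj
  · exact (hA i hin h1).elim
  · refine ⟨i, ?_, hin, hX, h1, h2⟩
    by_contra h'
    rw [show i - 1 = 0 by omega] at h1
    exact h.not_mem_AB h₀ h1

/-- A path of length at least three with both ends in `A 0` and no other vertex in
`A 0 ∪ A 1` is even. -/
theorem even_of_ends_mem_A (h : T.IsTwoJoinSplit X A B C) (hB : T.IsBerge)
    (hT : ¬ T.HasBalancedSkewPartition) {n : ℕ} {q : ℕ → V} (hn : 3 ≤ n) (hq : T.IsPathSeq n q)
    (h₀ : q 0 ∈ A 0) (h₁ : q n ∈ A 0) (hint : ∀ i, 0 < i → i < n → q i ∉ A 0 ∧ q i ∉ A 1) :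
    Even n := by
  by_cases hall : ∀ i ≤ n, q i ∈ X 0
  · obtain ⟨a₁, ha₁⟩ := h.nonempty_A 1
    exact hB.even_of_center hq (by omega) (h.strong_A _ h₀ _ ha₁).adj.symm
      (h.strong_A _ h₁ _ ha₁).adj.symm fun i hi0 hi =>
        h.antiAdj_of_mem_A_one ha₁ (hall i hi.le) (hint i hi0 hi).1
  push Not at hall
  have hA1 : ∀ i ≤ n, q i ∉ A 1 := by
    intro i hi
    have : i = 0 ∨ i = n ∨ 0 < i ∧ i < n := by omega
    rcases this with rfl | rfl | ⟨h', h''⟩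
    · exact fun h' => h.ne_cross (h.mem_of_mem_A h₀) (h.mem_of_mem_A h') rfl
    · exact fun h' => h.ne_cross (h.mem_of_mem_A h₁) (h.mem_of_mem_A h') rfl
    · exact (hint i h' h'').2
  obtain ⟨i, hi2, hin, hiX, hiB, hiB'⟩ := h.exists_first_exit hq h₀ hA1 hall
  obtain ⟨j, hj2, hjn, hjX, hjB, hjB'⟩ := h.exists_first_exit hq.reverse (by simpa using h₁)
    (fun i hi => hA1 _ (by omega)) (by
      obtain ⟨k, hk, hkX⟩ := hall
      exact ⟨n - k, by omega, by rwa [show n - (n - k) = k by omega]⟩)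
  -- The exit vertex `q i` in `B 1` is strongly adjacent to all of `B 0`, so only its two neighbours
  -- on the path can lie there.
  have huniq : ∀ k ≤ n, q k ∈ B 0 → k = i - 1 ∨ k = i + 1 := by
    intro k hk hkB
    have hs := h.strong_B _ hkB _ hiB'
    by_contra! hcon
    have : k + 2 ≤ i ∨ k = i ∨ i + 2 ≤ k := by omega
    rcases this with h' | rfl | h'
    · exact hs.not_antiAdj (hq.antiAdj k i h' hin)
    · exact hs.1 rfl
    · exact hs.symm.not_antiAdj (hq.antiAdj i k h' hk)
  -- The first exits from the two ends are the same vertex. Removing it leaves two paths from `A 0`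
  -- to `B 0` of lengths `i - 1` and `j - 1`, which have equal parity.
  have hij : i + j = n := by
    have h1 : ¬ n - j < i := fun h' => h.ne_cross (hiX _ h') (h.mem_of_mem_B hjB') rfl
    rcases huniq (n - (j - 1)) (by omega) hjB with h' | h' <;> omega
  obtain ⟨ℓ, r, hℓ, hr, hr0, hrℓ, hri⟩ := h.flip.exists_isPathSeq hB hT
  have hC : ∀ k, 0 < k → k < n → q k ∈ X 0 → k ≠ i - 1 → k ≠ i + 1 → q k ∈ C 0 := by
    intro k hk0 hk hkX h1 h2
    have := (h.mem_side 0 _).1 hkX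
    have := (hint k hk0 hk).1
    have := huniq k hk.le
    tauto
  have e1 := h.even_add hB (s := i - 1) (p := fun k => q (0 + k)) (by omega) hℓ (hq.sub (by omega))
    hr h₀ (by simpa using hiB)
    (fun k hk0 hk => by
      rw [zero_add]
      exact hC k hk0 (by omega) (hiX k (by omega)) (by omega) (by omega)) hr0 hrℓ hri
  have e2 := h.even_add hB (s := j - 1) (p := fun k => q (n - (0 + k))) (by omega) hℓ
    (hq.reverse.sub (by omega)) hr (by simpa using h₁) (by simpa using hjB)
    (fun k hk0 hk => by
      rw [zero_add]
      exact hC _ (by omega) (by omega) (hjX k (by omega)) (by omega) (by omega)) hr0 hrℓ hri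
  rw [Nat.even_iff] at *
  omega

/-- Every vertex of `A 0` has a neighbour in `C 0 ∪ B 0`. -/
theorem exists_adj (h : T.IsTwoJoinSplit X A B C) (hB : T.IsBerge)
    (hT : ¬ T.HasBalancedSkewPartition) {a : V} (ha : a ∈ A 0) :
    ∃ w ∈ C 0 ∪ B 0, T.Adj a w := by
  by_contra! hcon
  have hnadj : ∀ x, x ∉ A 0 → x ∉ A 1 → ¬ T.Adj a x := by
    intro x h0 h1 hadj
    rcases h.mem_or x with hx | hx
    · refine hcon x ?_ hadj
      rw [h.mem_side] at hx
      rw [Set.mem_union]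
      tauto
    · rcases h.adj_cross (h.mem_of_mem_A ha) hx hadj with h' | h'
      · exact h1 h'.2
      · exact h.not_mem_AB ha h'.1
  have hanti : ∀ x, x ∉ A 0 → x ∉ A 1 → T.AntiAdj a x := fun x h0 h1 =>
    antiAdj_of_not_adj (by rintro rfl; exact h0 ha) (hnadj x h0 h1)
  have hA01 : ∀ x ∈ A 0, x ∉ A 1 := fun x h0 h1 =>
    h.ne_cross (h.mem_of_mem_A h0) (h.mem_of_mem_A h1) rfl
  obtain ⟨a', ha', haa'⟩ : ∃ a' ∈ A 0, a' ≠ a := by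
    by_contra! hA
    obtain ⟨b, rfl, hb⟩ := h.exists_mem_B_of_closed hB hT (K := {a})
      (by simpa using h.mem_of_mem_A ha)
      (by
        rintro u rfl w hw huw
        by_contra hwa
        exact hnadj w (fun h' => hwa (hA w h'))
          (fun h' => h.ne_cross hw (h.mem_of_mem_A h') rfl) huw) ⟨a, rfl⟩
    exact h.not_mem_AB ha hb
  obtain ⟨a₁, ha₁⟩ := h.nonempty_A 1
  obtain ⟨b, hb⟩ := h.nonempty_B 0
  -- `a` has no neighbour outside the cutset
  have hout : ∀ x, x ∉ A 0 \ {a} ∪ A 1 → ¬ T.Adj a x := by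
    intro x hx hax
    by_cases hxA : x ∈ A 0
    · exact hx (Or.inl ⟨hxA, hax.ne.symm⟩)
    · exact hnadj x hxA (fun h' => hx (Or.inr h')) hax
  -- This cutset isolates `a`. It is not a star: it fails to be anticonnected because `A 0 \ {a}` is
  -- nonempty and strongly complete to `A 1`.
  refine hT (hasBalancedSkewPartition_of (A 0 \ {a} ∪ A 1) {a} (A 0) ?_ ⟨a, ?_, rfl⟩
    ⟨b, ?_, ?_⟩ ?_ ⟨a', Or.inl ⟨ha', haa'⟩, ha'⟩ ⟨a₁, Or.inr ha₁, fun h' => hA01 _ h' ha₁⟩ ?_ ?_)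
  · rintro u _ w hw rfl huw
    exact (hout w hw huw).elim
  · rintro (h' | h')
    · exact h'.2 rfl
    · exact hA01 a ha h'
  · rintro (h' | h')
    · exact h.not_mem_AB h'.1 hb
    · exact h.ne_cross (h.mem_of_mem_B hb) (h.mem_of_mem_A h') rfl
  · rintro rfl
    exact h.not_mem_AB ha hb
  · rintro u _ w (hw | hw) hu hw'
    · exact (hw' hw.1).elim
    · exact h.strong_A u hu w hw
  · intro n q hn h3 hq h0 h1 hint
    have h0n := hq.antiAdj 0 n (by omega) le_rfl
    have hina : ∀ i, 0 < i → i < n → q i ≠ a := by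
      intro i hi0 hi hia
      by_cases h : i + 1 < n
      · exact hout _ (hint (i + 1) (by omega) h) (hia ▸ hq.adj i hi)
      · have := (hq.adj (i - 1) (by omega)).symm
        rw [show i - 1 + 1 = i by omega, hia] at this
        exact hout _ (hint (i - 1) (by omega) (by omega)) this
    have hint' : ∀ i, 0 < i → i < n → q i ∉ A 0 ∧ q i ∉ A 1 := fun i hi0 hi =>
      ⟨fun h' => hint i hi0 hi (Or.inl ⟨h', hina i hi0 hi⟩), fun h' => hint i hi0 hi (Or.inr h')⟩
    refine Nat.not_even_iff_odd.2 hn ?_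
    rcases h0 with h0 | h0 <;> rcases h1 with h1 | h1
    · exact h.even_of_ends_mem_A hB hT h3 hq h0.1 h1.1 hint'
    · exact ((h.strong_A _ h0.1 _ h1).not_antiAdj h0n).elim
    · exact ((h.strong_A _ h1.1 _ h0).symm.not_antiAdj h0n).elim
    · exact h.flip.even_of_ends_mem_A hB hT h3 hq h0 h1 fun i hi0 hi => (hint' i hi0 hi).symm
  · intro n q hn h5 hq h0 h1 hint
    -- Consecutive interior vertices are antiadjacent, so the interior stays in `A 0` or in `A 1`;
    -- it is completed by `a₁` or by `a` respectively. In the first case no end equals `a`, since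
    -- the ends are adjacent to each other and `a` has no neighbour outside the cutset.
    by_cases hq1 : q 1 ∈ A 0
    · have hintA : ∀ i, 0 < i → i < n → q i ∈ A 0 := hq.interior_mem (P := (· ∈ A 0)) hq1
        fun i hi0 hi hiA hadj => ((hint (i + 1) (by omega) hi).resolve_right fun h' =>
          (h.strong_A _ hiA _ h').not_antiAdj (compl_adj.1 hadj)).1
      obtain ⟨h0n, ⟨s, hs, hs'⟩, ⟨t, ht, ht'⟩, ⟨u, hu, hu'⟩, ⟨v, hv, hv'⟩⟩ :=
        antipath_ends hq h5 hintA
      have key : ∀ y s, s ∈ A 0 → T.Adj y s → y ∉ A 0 \ {a} ∪ A 1 → y ≠ a →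
          T.AntiAdj a₁ y := by
        intro y s hs hys hy hya
        refine h.antiAdj_of_mem_A_one ha₁ ((h.mem_or y).resolve_right fun hy1 => ?_)
          fun h' => hy (Or.inl ⟨h', hya⟩)
        rcases h.adj_cross (h.mem_of_mem_A hs) hy1 hys.symm with h' | h'
        · exact hy (Or.inr h'.2)
        · exact h.not_mem_AB hs h'.1
      exact Nat.not_even_iff_odd.2 hn (hB.even_of_center_compl hq (by omega)
        (key _ s hs hs' h0 fun h' => hout _ h1 (h' ▸ h0n))
        (key _ u hu hu' h1 fun h' => hout _ h0 (h' ▸ h0n.symm))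
        fun i hi0 hi => (h.strong_A _ (hintA i hi0 hi) _ ha₁).adj.symm)
    · have hintA : ∀ i, 0 < i → i < n → q i ∈ A 1 := hq.interior_mem (P := (· ∈ A 1))
        ((hint 1 (by omega) (by omega)).resolve_left fun h' => hq1 h'.1)
        fun i hi0 hi hiA hadj => (hint (i + 1) (by omega) hi).resolve_left fun h' =>
          (h.strong_A _ h'.1 _ hiA).symm.not_antiAdj (compl_adj.1 hadj)
      obtain ⟨-, -, ⟨t, ht, ht'⟩, -, ⟨v, hv, hv'⟩⟩ := antipath_ends hq h5 hintA
      have key : ∀ y t, t ∈ A 1 → T.AntiAdj y t → y ∉ A 0 \ {a} ∪ A 1 → T.AntiAdj a y :=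
        fun y t ht hyt hy => hanti y (fun h' => (h.strong_A y h' t ht).not_antiAdj hyt)
          fun h' => hy (Or.inr h')
      exact Nat.not_even_iff_odd.2 hn (hB.even_of_center_compl hq (by omega)
        (key _ t ht ht' h0) (key _ v hv hv' h1)
        fun i hi0 hi => (h.strong_A _ ha _ (hintA i hi0 hi)).adj)

end IsTwoJoinSplit

/-! ### Switchable pairs and small sides -/

/-- In a trigraph of the class `F`, no vertex lies in three switchable pairs. -/
theorem InClassF.eq_or_eq_of_semiAdj [Finite V] (hF : T.InClassF) {a x y z : V} (hxy : x ≠ y)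
    (hx : T.SemiAdj a x) (hy : T.SemiAdj a y) (hz : T.SemiAdj a z) : z = x ∨ z = y := by
  by_contra! hcon
  let c := T.switchableGraph.connectedComponentMk a
  have mem : ∀ w, T.SemiAdj a w → w ∈ c.supp := fun w hw =>
    (SimpleGraph.ConnectedComponent.mem_supp_iff _ _).2
      (SimpleGraph.ConnectedComponent.sound
        (SimpleGraph.Adj.reachable (G := T.switchableGraph) hw.symm))
  let e : ∀ w, T.SemiAdj a w → Sym2 c := fun w hw => s(⟨a, rfl⟩, ⟨w, mem w hw⟩)
  have he : ∀ w hw, e w hw ∈ c.toSimpleGraph.edgeSet := fun w hw => hw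
  have hne : ∀ w w' hw hw', w ≠ w' → e w hw ≠ e w' hw' := by
    intro w w' hw hw' hww' heq
    simp only [e, Sym2.eq_iff, Subtype.mk.injEq] at heq
    rcases heq with h' | h'
    · exact hww' h'.2
    · exact hww' (congrArg Subtype.val (h'.2.trans h'.1))
  have hsub : {e x hx, e y hy, e z hz} ⊆ c.toSimpleGraph.edgeSet := by
    rintro _ (rfl | rfl | rfl)
    exacts [he x hx, he y hy, he z hz]
  have h3 := Set.ncard_eq_three.2 ⟨e x hx, e y hy, e z hz, hne x y hx hy hxy,
    hne x z hx hz hcon.1.symm, hne y z hy hz hcon.2.symm, rfl⟩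
  have := Set.ncard_le_ncard hsub (Set.toFinite _)
  have := hF.component_edges c
  omega

namespace IsTwoJoinSplit

variable {X A B C : Fin 2 → Set V}

/-- Every vertex of `X 0` has a neighbour in `X 0`. -/
theorem exists_adj_side (h : T.IsTwoJoinSplit X A B C) (hB : T.IsBerge)
    (hT : ¬ T.HasBalancedSkewPartition) {v : V} (hv : v ∈ X 0) : ∃ w ∈ X 0, T.Adj v w := by
  by_contra! hcon
  have hK : ∀ u ∈ ({v} : Set V), ∀ w ∈ X 0, T.Adj u w → w ∈ ({v} : Set V) := by
    rintro u rfl w hw huw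
    exact (hcon w hw huw).elim
  obtain ⟨_, rfl, hb⟩ := h.exists_mem_B_of_closed hB hT (by simpa using hv) hK ⟨v, rfl⟩
  obtain ⟨_, rfl, ha⟩ := h.swap.exists_mem_B_of_closed hB hT (by simpa using hv) hK ⟨_, rfl⟩
  exact h.not_mem_AB ha hb

/-- If `C 0` is empty, then `A 0` has at least two elements. -/
theorem two_le_ncard_A [Finite V] (h : T.IsTwoJoinSplit X A B C) (hF : T.InClassF)
    (hT : ¬ T.HasBalancedSkewPartition) (hC : C 0 = ∅) : 2 ≤ (A 0).ncard := by
  by_contra hlt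
  have hpos := (Set.ncard_pos (Set.toFinite _)).2 (h.nonempty_A 0)
  obtain ⟨a, ha⟩ := Set.ncard_eq_one.1 (show (A 0).ncard = 1 by omega)
  have haA : a ∈ A 0 := ha ▸ rfl
  -- The neighbour and the antineighbour that `b` must have can only be `a`.
  have hsemi : ∀ b ∈ B 0, T.SemiAdj a b := by
    intro b hb
    obtain ⟨a', ha', h1⟩ := h.swap.exists_antiAdj hF.berge hT hb
    obtain ⟨w, hw, h2⟩ := h.swap.exists_adj hF.berge hT hb
    rw [hC, Set.empty_union] at hw
    rw [ha] at ha' hw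
    obtain rfl : a' = a := ha'
    obtain rfl : w = a' := hw
    exact semiAdj_of_adj_of_antiAdj h2.symm h1.symm
  obtain ⟨x, hx⟩ := h.nonempty_B 0
  obtain ⟨y, hy, hxy⟩ : ∃ y ∈ B 0, x ≠ y := by
    by_contra! hcon
    have : X 0 ⊆ {a, x} := fun z hz => by
      rw [h.mem_side, ha, hC] at hz
      rcases hz with hz | hz | hz
      · exact Or.inl hz
      · exact Or.inr (hcon z hz).symm
      · exact hz.elim
    have := Set.ncard_le_ncard this
    have := Set.ncard_insert_le a {x}
    rw [Set.ncard_singleton] at this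
    have := h.three_le 0
    omega
  obtain ⟨a₁, ha₁⟩ := h.nonempty_A 1
  obtain ⟨b₁, hb₁⟩ := h.nonempty_B 1
  have hmem : ∀ w ∈ X 1, w ∉ ({a, x, y} : Set V) := by
    rintro w hw (rfl | rfl | rfl)
    · exact h.ne_cross (h.mem_of_mem_A haA) hw rfl
    · exact h.ne_cross (h.mem_of_mem_B hx) hw rfl
    · exact h.ne_cross (h.mem_of_mem_B hy) hw rfl
  have hnbr : T.switchableGraph.neighborSet a = {x, y} := by
    ext z
    constructor
    · exact hF.eq_or_eq_of_semiAdj hxy (hsemi x hx) (hsemi y hy)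
    · rintro (rfl | rfl)
      · exact hsemi _ hx
      · exact hsemi _ hy
  -- A heavy `a` would be strongly adjacent to `b₁`, and a light one strongly antiadjacent to `a₁`.
  rcases hF.heavy_or_light a x y hxy hnbr with h' | h'
  · exact (h'.1 b₁ (hmem b₁ (h.mem_of_mem_B hb₁))).not_antiAdj
      (h.antiAdj_of_mem_A_zero haA (h.mem_of_mem_B hb₁) fun h'' => h.not_mem_AB h'' hb₁)
  · exact (h.strong_A a haA a₁ ha₁).not_antiAdj (Or.inl (h'.1 a₁ (hmem a₁ (h.mem_of_mem_A ha₁))))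

/-- If `X 0 = {a, b, c}`, where `a ∈ A 0`, `b ∈ B 0` and `c ∈ C 0`, then `c` is adjacent to `b`. -/
theorem adj_of_side_eq (h : T.IsTwoJoinSplit X A B C)
    (hT : ¬ T.HasBalancedSkewPartition) {a b c : V} (ha : a ∈ A 0) (hb : b ∈ B 0) (hc : c ∈ C 0)
    (hX : X 0 ⊆ {a, b, c}) : T.Adj c b := by
  by_contra hcb
  obtain ⟨a₁, ha₁⟩ := h.nonempty_A 1
  have hcX : c ∈ X 0 := (h.mem_side 0 c).2 (Or.inr (Or.inr hc))
  refine hT (hasBalancedSkewPartition_of_strongAdj (h.strong_A a ha a₁ ha₁) {c} ?_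
    ⟨c, ?_, h.ne_cross hcX (h.mem_of_mem_A ha₁), rfl⟩
    ⟨b, ?_, h.ne_cross (h.mem_of_mem_B hb) (h.mem_of_mem_A ha₁), ?_⟩)
  · rintro x - - y hya - rfl hxy
    rcases h.mem_or y with hy | hy
    · rcases hX hy with rfl | rfl | rfl
      · exact (hya rfl).elim
      · exact (hcb hxy).elim
      · rfl
    · rcases h.adj_cross hcX hy hxy with h' | h'
      · exact (h.not_mem_AC h'.1 hc).elim
      · exact (h.not_mem_BC h'.1 hc).elim
  · rintro rfl
    exact h.not_mem_AC ha hc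
  · rintro rfl
    exact h.not_mem_AB ha hb
  · rintro rfl
    exact h.not_mem_BC hb hc

/-- `X 0` has at least four elements. -/
theorem four_le_ncard [Finite V] (h : T.IsTwoJoinSplit X A B C) (hF : T.InClassF)
    (hT : ¬ T.HasBalancedSkewPartition) : 4 ≤ (X 0).ncard := by
  rcases Set.eq_empty_or_nonempty (C 0) with hC | ⟨c, hc⟩
  · have h1 := h.two_le_ncard_A hF hT hC
    have h2 := h.swap.two_le_ncard_A hF hT hC
    rw [h.side_eq, hC, Set.union_empty, Set.ncard_union_eq (h.disjoint_AB 0)]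
    omega
  by_contra hlt
  obtain ⟨a, ha⟩ := h.nonempty_A 0
  obtain ⟨b, hb⟩ := h.nonempty_B 0
  have hab : a ≠ b := by rintro rfl; exact h.not_mem_AB ha hb
  have hac : a ≠ c := by rintro rfl; exact h.not_mem_AC ha hc
  have hbc : b ≠ c := by rintro rfl; exact h.not_mem_BC hb hc
  have hcX : c ∈ X 0 := (h.mem_side 0 c).2 (Or.inr (Or.inr hc))
  have h3 := Set.ncard_eq_three.2 ⟨a, b, c, hab, hac, hbc, rfl⟩
  have hX : {a, b, c} = X 0 := Set.eq_of_subset_of_ncard_le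
    (by rintro _ (rfl | rfl | rfl); exacts [h.mem_of_mem_A ha, h.mem_of_mem_B hb, hcX]) (by omega)
  have hX' : X 0 = {a, c, b} := by rw [← hX, Set.pair_comm]
  have hA : A 0 = {a} := by
    refine Set.eq_singleton_iff_unique_mem.2 ⟨ha, fun x hx => ?_⟩
    rcases hX ▸ h.mem_of_mem_A hx with rfl | rfl | rfl
    · rfl
    · exact (h.not_mem_AB hx hb).elim
    · exact (h.not_mem_AC hx hc).elim
  have hB : B 0 = {b} := by
    refine Set.eq_singleton_iff_unique_mem.2 ⟨hb, fun x hx => ?_⟩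
    rcases hX ▸ h.mem_of_mem_B hx with rfl | rfl | rfl
    · exact (h.not_mem_AB ha hx).elim
    · rfl
    · exact (h.not_mem_BC hx hc).elim
  have hcb : T.Adj c b := h.adj_of_side_eq hT ha hb hc hX.ge
  have hca : T.Adj c a := h.swap.adj_of_side_eq hT hb ha hc
    (by rw [Set.insert_comm]; exact hX.ge)
  obtain ⟨b', hb', hanti⟩ := h.exists_antiAdj hF.berge hT ha
  obtain rfl : b' = b := by simpa [hB] using hb'
  -- If `a` and `b'` are adjacent, they are a switchable pair, so both `a, b'` and `a, c, b'` are
  -- paths, of lengths 1 and 2, against the common parity.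
  by_cases hadj : T.Adj a b'
  · obtain ⟨ℓ, r, hℓ, hr, hr0, hrℓ, hri⟩ := h.flip.exists_isPathSeq hF.berge hT
    have e1 := h.even_add hF.berge (s := 1) (p := fun i => if i = 0 then a else b') le_rfl hℓ
      ⟨fun i hi => by
        obtain rfl : i = 0 := by omega
        simpa using hadj, fun i j hij hj => by omega⟩ hr (by simpa using ha)
      (by simpa using hb) (fun i h0 h1 => by omega) hr0 hrℓ hri
    have e2 := h.even_add hF.berge (s := 2)
      (p := fun i => if i = 0 then a else if i = 1 then c else b') (by omega) hℓ
      ⟨fun i hi => by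
        obtain rfl | rfl : i = 0 ∨ i = 1 := by omega
        · simpa using hca.symm
        · simpa using hcb, fun i j hij hj => by
        obtain ⟨rfl, rfl⟩ : i = 0 ∧ j = 2 := by omega
        simpa using hanti⟩ hr (by simpa using ha)
      (by simpa using hb) (fun i h0 h1 => by
        obtain rfl : i = 1 := by omega
        simpa using hc) hr0 hrℓ hri
    rw [Nat.even_iff] at e1 e2
    omega
  · exact h.not_path 0 ⟨a, c, b', hA, hB, hX', hca.symm, hcb, hadj⟩

/-- The 2-join is proper. -/
theorem isProperTwoJoin (h : T.IsTwoJoinSplit X A B C) (hB : T.IsBerge)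
    (hT : ¬ T.HasBalancedSkewPartition) : T.IsProperTwoJoin X := by
  refine ⟨⟨A, B, C, h⟩, fun A B C h i K hK => ?_⟩
  have hclosed : ∀ u ∈ K, ∀ w ∈ X i, T.Adj u w → w ∈ K := fun u hu w hw => hK.mem_of_adj hu hw
  obtain ⟨hne, hsub, -⟩ := hK.prop
  fin_cases i
  · exact ⟨h.swap.exists_mem_B_of_closed hB hT hsub hclosed hne,
      h.exists_mem_B_of_closed hB hT hsub hclosed hne⟩
  · exact ⟨h.flip.swap.exists_mem_B_of_closed hB hT hsub hclosed hne,
      h.flip.exists_mem_B_of_closed hB hT hsub hclosed hne⟩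

end IsTwoJoinSplit
end Trigraph

theorem mainTheorem12 {V : Type*} [Finite V] (T : Trigraph V) (hF : T.InClassF)
    (hT : ¬ T.HasBalancedSkewPartition) (X A B C : Fin 2 → Set V)
    (hsplit : T.IsTwoJoinSplit X A B C) :
    T.IsProperTwoJoin X ∧
    (∀ i, ∀ v ∈ X i, ∃ w ∈ X i, T.Adj v w) ∧
    (∀ i, ∀ a ∈ A i, ∃ b ∈ B i, T.AntiAdj a b) ∧
    (∀ i, ∀ b ∈ B i, ∃ a ∈ A i, T.AntiAdj b a) ∧
    (∀ i, ∀ a ∈ A i, ∃ w ∈ C i ∪ B i, T.Adj a w) ∧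
    (∀ i, ∀ b ∈ B i, ∃ w ∈ C i ∪ A i, T.Adj b w) ∧
    (∀ i, C i = ∅ → 2 ≤ (A i).ncard ∧ 2 ≤ (B i).ncard) ∧
    (∀ i, 4 ≤ (X i).ncard) := by
  have hB := hF.berge
  -- The arguments treat side `0`, mostly from the `A`-part; `flip` and `swap` supply the remaining
  -- cases.
  have hflip := hsplit.flip
  refine ⟨hsplit.isProperTwoJoin hB hT, ?_, ?_, ?_, ?_, ?_, ?_, ?_⟩ <;>
    refine Fin.forall_fin_two.2 ⟨?_, ?_⟩
  · exact fun v hv => hsplit.exists_adj_side hB hT hv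
  · exact fun v hv => hflip.exists_adj_side hB hT hv
  · exact fun a ha => hsplit.exists_antiAdj hB hT ha
  · exact fun a ha => hflip.exists_antiAdj hB hT ha
  · exact fun b hb => hsplit.swap.exists_antiAdj hB hT hb
  · exact fun b hb => hflip.swap.exists_antiAdj hB hT hb
  · exact fun a ha => hsplit.exists_adj hB hT ha
  · exact fun a ha => hflip.exists_adj hB hT ha
  · exact fun b hb => hsplit.swap.exists_adj hB hT hb
  · exact fun b hb => hflip.swap.exists_adj hB hT hb
  · exact fun hC => ⟨hsplit.two_le_ncard_A hF hT hC, hsplit.swap.two_le_ncard_A hF hT hC⟩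
  · exact fun hC => ⟨hflip.two_le_ncard_A hF hT hC, hflip.swap.two_le_ncard_A hF hT hC⟩
  · exact hsplit.four_le_ncard hF hT
  · exact hflip.four_le_ncard hF hT
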